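/- Let $F$ be a field of arbitrary characteristic. Let $(B,\tau)$ be an $F$-quaternion algebra (a central simple $F$-algebra of dimension $4$, possibly split) with its canonical involution $\tau(x)=\mathrm{Trd}_B(x)-x$. Let $(A,\sigma)$ and $(A',\sigma')$ be finite-dimensional central simple $F$-algebras with symplectic $F$-linear involutions such that $A$ and $A'$ are Brauer equivalent to $B$. (An involution is symplectic if, over some splitting field, it is adjoint to a nondegenerate alternating bilinear form.) Write $\mathrm{Sym}(C,\rho)=\{x\in C\mid \rho(x)=x\}$. A semi-trace on an algebra with involution $(C,\rho)$ is an $F$-linear map $f:\mathrm{Sym}(C,\rho)\to F$ with $f(x+\rho(x))=\mathrm{Trd}_C(x)$ for all $x\in C$. There is a unique semi-trace $h$ on $(A\otimes_F B,\sigma\otimes\tau)$ such that $h(s\otimes t)=0$ for all $s\in\mathrm{Sym}(A,\sigma)$, $t\in \mathrm{Sym}(B,\tau)$ if $\mathrm{char}(F)=2$, and $h=\tfrac12\mathrm{Trd}_{A\otimes_F B}$ on $\mathrm{Sym}(A\otimes_F B,\sigma\otimes\tau)$ if $\mathrm{char}(F)\neq 2$. Let $(A,\sigma)\boxtimes(B,\tau)$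 denote the $F$-algebra with quadratic pair $(A\otimes_F B,\sigma\otimes\tau,h)$, and define $(A',\sigma')\boxtimes(B,\tau)$ in the same way. An algebra with involution $(C,\rho)$ is isotropic if $\rho(a)a=0$ for some $a\in C\setminus\{0\}$, and hyperbolic if $\rho(e)=1-e$ for some idempotent $e\in C$. An algebra with quadratic pair $(C,\rho,f)$ is isotropic if there is a nonzero right ideal $I$ of $C$ with $\rho(x)y=0$ for all $x,y\in I$ and $f(s)=0$ for all $s\in I\cap\mathrm{Sym}(C,\rho)$, and hyperbolic if there is an idempotent $e\in C$ with $f(s)=\mathrm{Trd}_C(es)$ for all $s\in\mathrm{Sym}(C,\rho)$. Isomorphisms of algebras with involution are $F$-algebra isomorphisms commuting with the involutions; isomorphisms of algebras with quadratic pair must in addition be compatible with the semi-traces. Then: 1. $(A,\sigma)$ is isotropic if and only if $(A,\sigma)\boxtimes(B,\tau)$ is isotropic; 2. $(A,\sigma)$ is hyperbolic if and only if $(A,\sigma)\boxtimes(B,\tau)$ is hyperbolic; 3. $(A,\sigma)\simeq(A',\sigma')$ if and only if $(A,\sigma)\boxtimes(B,\tau)\simeq(A',\sigma')\boxtimes(B,\tau)$.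 -/

import Mathlib

open scoped TensorProduct

universe u v w

section Brauer

/-- Brauer equivalence of two central simple `F`-algebras (Mathlib's notion, for unbundled
algebras). -/
def BrauerEquiv (F : Type u) [Field F] (A B : Type v)
    [Ring A] [Algebra F A] [Algebra.IsCentral F A] [IsSimpleRing A] [FiniteDimensional F A]
    [Ring B] [Algebra F B] [Algebra.IsCentral F B] [IsSimpleRing B] [FiniteDimensional F B] :
    Prop :=
  IsBrauerEquivalent (K := F) (CSA.mk (AlgCat.of F A)) (CSA.mk (AlgCat.of F B))

end Brauer

section ReducedTrace

variable (F : Type u) [Field F] {A : Type v} [Ring A] [Algebra F A]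

/-- `t : F` is the trace of `a`, computed after splitting `A` over an algebraic closure of `F`. -/
def IsReducedTrace (a : A) (t : F) : Prop :=
  ∀ (n : ℕ) (Φ : (AlgebraicClosure F ⊗[F] A) ≃ₐ[AlgebraicClosure F]
      Matrix (Fin n) (Fin n) (AlgebraicClosure F)),
    algebraMap F (AlgebraicClosure F) t = Matrix.trace (Φ (1 ⊗ₜ[F] a))

open Classical in
/-- The reduced trace `Trd_A(a)` of an element of a central simple `F`-algebra `A`: the element
of `F` that is the trace of the image of `a` under an (equivalently, any) isomorphism from the
base change of `A` to an algebraic closure onto a matrix algebra. For a central simple algebra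
exactly one such element exists; the value `0` in the other branch is only a default. -/
noncomputable def reducedTrace (a : A) : F :=
  if h : ∃ t : F, IsReducedTrace F a t then h.choose else 0

end ReducedTrace

section Involution

/-- An `F`-linear involution on an `F`-algebra `A`: an anti-automorphism of order at most two.
If `A` is central simple over `F`, this is an involution of the first kind. -/
structure AlgInvolution (F : Type u) [Field F] (A : Type v) [Ring A] [Algebra F A] where
  /-- the underlying linear map -/
  toLin : A →ₗ[F] A
  map_mul_rev : ∀ x y : A, toLin (x * y) = toLin y * toLin x
  map_map : ∀ x : A, toLin (toLin x) = x

namespace AlgInvolution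

variable {F : Type u} [Field F] {A : Type v} [Ring A] [Algebra F A]
  {B : Type w} [Ring B] [Algebra F B]

instance : CoeFun (AlgInvolution F A) (fun _ => A → A) := ⟨fun σ => σ.toLin⟩

/-- The subspace `Sym(A, σ)` of the elements fixed by `σ`. -/
def sym (σ : AlgInvolution F A) : Submodule F A where
  carrier := {x | σ x = x}
  add_mem' {x y} hx hy := by
    simp only [Set.mem_ofPred_eq] at hx hy ⊢
    rw [map_add, hx, hy]
  zero_mem' := map_zero σ.toLin
  smul_mem' c x hx := by
    simp only [Set.mem_ofPred_eq] at hx ⊢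
    rw [map_smul, hx]

theorem mem_sym {σ : AlgInvolution F A} {x : A} : x ∈ σ.sym ↔ σ x = x := Iff.rfl

theorem add_map_mem_sym (σ : AlgInvolution F A) (x : A) : x + σ x ∈ σ.sym := by
  rw [mem_sym, map_add, σ.map_map, add_comm]

/-- The involution `σ ⊗ τ` on `A ⊗ B`, with `(σ ⊗ τ)(a ⊗ b) = σ(a) ⊗ τ(b)`. -/
noncomputable def tensor (σ : AlgInvolution F A) (τ : AlgInvolution F B) :
    AlgInvolution F (A ⊗[F] B) where
  toLin := TensorProduct.map σ.toLin τ.toLin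
  map_mul_rev x y := by
    induction x using TensorProduct.induction_on with
    | zero => simp
    | add x₁ x₂ h₁ h₂ => simp only [add_mul, mul_add, map_add, h₁, h₂]
    | tmul a b =>
      induction y using TensorProduct.induction_on with
      | zero => simp
      | add y₁ y₂ h₁ h₂ => simp only [add_mul, mul_add, map_add, h₁, h₂]
      | tmul a' b' =>
        simp only [Algebra.TensorProduct.tmul_mul_tmul, TensorProduct.map_tmul, σ.map_mul_rev,
          τ.map_mul_rev]
  map_map x := by
    induction x using TensorProduct.induction_on with
    | zero => simp
    | add x₁ x₂ h₁ h₂ => simp only [map_add, h₁, h₂]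
    | tmul a b => simp only [TensorProduct.map_tmul, σ.map_map, τ.map_map]

theorem tmul_mem_sym {σ : AlgInvolution F A} {τ : AlgInvolution F B} {s : A} {t : B}
    (hs : s ∈ σ.sym) (ht : t ∈ τ.sym) : s ⊗ₜ[F] t ∈ (σ.tensor τ).sym := by
  rw [mem_sym] at hs ht ⊢
  change TensorProduct.map σ.toLin τ.toLin (s ⊗ₜ[F] t) = _
  rw [TensorProduct.map_tmul, hs, ht]

/-- `σ` is symplectic: over some splitting field `K` of `A`, it is adjoint to a nondegenerate
alternating bilinear form. -/
def IsSymplectic (σ : AlgInvolution F A) : Prop :=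
  ∃ (K : Type u) (_ : Field K) (_ : Algebra F K)
    (V : Type u) (_ : AddCommGroup V) (_ : Module K V) (_ : FiniteDimensional K V)
    (b : LinearMap.BilinForm K V) (Φ : (K ⊗[F] A) ≃ₐ[K] Module.End K V),
    b.IsAlt ∧ b.Nondegenerate ∧
      ∀ (z : K ⊗[F] A) (x y : V), b (Φ z x) y = b x (Φ (σ.toLin.baseChange K z) y)

/-- The canonical involution `x ↦ Trd(x) - x` (of a quaternion algebra). -/
def IsCanonical (σ : AlgInvolution F A) : Prop :=
  ∀ x : A, σ x = algebraMap F A (reducedTrace F x) - x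

/-- `(A, σ)` is isotropic. -/
def IsIsotropic (σ : AlgInvolution F A) : Prop := ∃ a : A, a ≠ 0 ∧ σ a * a = 0

/-- `(A, σ)` is hyperbolic. -/
def IsHyperbolic (σ : AlgInvolution F A) : Prop :=
  ∃ e : A, IsIdempotentElem e ∧ σ e = 1 - e

/-- `e` is an isomorphism `(A, σ) → (B, τ)` of algebras with involution. -/
def IsIso (σ : AlgInvolution F A) (τ : AlgInvolution F B) (e : A ≃ₐ[F] B) : Prop :=
  ∀ x : A, e (σ x) = τ (e x)

theorem IsIso.map_mem_sym {σ : AlgInvolution F A} {τ : AlgInvolution F B} {e : A ≃ₐ[F] B}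
    (he : IsIso σ τ e) {x : A} (hx : x ∈ σ.sym) : e x ∈ τ.sym := by
  rw [mem_sym] at hx ⊢
  rw [← he x, hx]

/-- `(A, σ)` and `(B, τ)` are isomorphic as algebras with involution. -/
def Isomorphic (σ : AlgInvolution F A) (τ : AlgInvolution F B) : Prop :=
  ∃ e : A ≃ₐ[F] B, IsIso σ τ e

end AlgInvolution

end Involution

section SemiTrace

/-- A semi-trace on `(A, σ)`: a linear form `f` on `Sym(A, σ)` with `f(x + σ(x)) = Trd(x)`. For
a central simple `A` and `σ` orthogonal (characteristic not two) or symplectic (characteristic two),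
the triple `(A, σ, f)` is an algebra with quadratic pair. -/
structure SemiTrace {F : Type u} [Field F] {A : Type v} [Ring A] [Algebra F A]
    (σ : AlgInvolution F A) where
  /-- the underlying linear form -/
  toLin : σ.sym →ₗ[F] F
  apply_add_map : ∀ x : A, toLin ⟨x + σ x, σ.add_map_mem_sym x⟩ = reducedTrace F x

namespace SemiTrace

variable {F : Type u} [Field F] {A : Type v} [Ring A] [Algebra F A]
  {B : Type w} [Ring B] [Algebra F B] {σ : AlgInvolution F A} {τ : AlgInvolution F B}

/-- `(A, σ, f)` is isotropic: there is a nonzero right ideal `I` of `A` with `σ(I) I = 0` and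
`f = 0` on `I ∩ Sym(A, σ)`. -/
def IsIsotropic (f : SemiTrace σ) : Prop :=
  ∃ I : Submodule Aᵐᵒᵖ A, I ≠ ⊥ ∧ (∀ x ∈ I, ∀ y ∈ I, σ x * y = 0) ∧
    ∀ s : σ.sym, (s : A) ∈ I → f.toLin s = 0

/-- `(A, σ, f)` is hyperbolic: there is an idempotent `e` of `A` with `f(s) = Trd(e s)` for all
`s` in `Sym(A, σ)`. -/
def IsHyperbolic (f : SemiTrace σ) : Prop :=
  ∃ e : A, IsIdempotentElem e ∧ ∀ s : σ.sym, f.toLin s = reducedTrace F (e * (s : A))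

/-- `(A, σ, f)` and `(B, τ, g)` are isomorphic: there is an isomorphism `e` of algebras with
involution with `f = g ∘ e`. -/
def Isomorphic (f : SemiTrace σ) (g : SemiTrace τ) : Prop :=
  ∃ (e : A ≃ₐ[F] B) (he : AlgInvolution.IsIso σ τ e),
    ∀ s : σ.sym, f.toLin s = g.toLin ⟨e s, he.map_mem_sym s.2⟩

/-- `h` is the semi-trace on `(A, σ) ⊗ (B, τ)` for which `(A ⊗ B, σ ⊗ τ, h)` is the algebra with
quadratic pair `(A, σ) ⊠ (B, τ)`: in characteristic two it vanishes on the tensors of symmetric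
elements, otherwise it is half of the reduced trace. -/
structure IsBox (σ : AlgInvolution F A) (τ : AlgInvolution F B)
    (h : SemiTrace (σ.tensor τ)) : Prop where
  char_two : CharP F 2 → ∀ (s : A) (hs : s ∈ σ.sym) (t : B) (ht : t ∈ τ.sym),
    h.toLin ⟨s ⊗ₜ[F] t, AlgInvolution.tmul_mem_sym hs ht⟩ = 0
  char_ne_two : ¬ CharP F 2 → ∀ x : (σ.tensor τ).sym,
    h.toLin x = 2⁻¹ * reducedTrace F (x : A ⊗[F] B)

end SemiTrace

end SemiTrace

/-! ### Reduced traces of split algebras. -/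

section SplitTrace

variable {F : Type u} [Field F]

/-! Since `A` is Brauer equivalent to `B`, and `τ` identifies `B` with its opposite, `A ⊗ B` is
`End_F(V)` for a `B`-module `V`, and `A` is the centralizer `End_B(V)`. The involution `σ ⊗ τ` is
adjoint to a nondegenerate form `b` on `V`, in effect the reduced trace of a hermitian form over
`(B, τ)`. It is symmetric, in characteristic not two by a dimension count. Symplecticity also
provides `a` with `a + σ(a) = 1`, in every characteristic; this makes the form even: `b(x, βx) = 0`
whenever `τ(β) = -β`.

Fix `θ` in `B` of reduced trace 1. The semi-trace of the box product is `s ↦ Trd((1 ⊗ θ)s)`. It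
encodes the quadratic form `q(x) = b(x, θx)`, whose polar form is `b`. Every `β` differs from a
multiple of `θ` by a skew element, so `q(x) = 0` forces `b(x, βx) = 0` for all `β`: singular vectors
of `q` generate totally isotropic `B`-submodules (`IsEvenForm.apply_self_smul_eq_zero`).

Totally isotropic submodules yield idempotents of `A` (`HermitianModel.exists_idempotent`), which
settles isotropy. For hyperbolicity, a totally singular subspace of half the dimension forces a
totally isotropic `B`-submodule of half the dimension (`IsEvenForm.exists_lagrangian`). An
isomorphism of quadratic pairs gives, by Skolem–Noether, a similitude of the forms `q`, hence an
isometry after rescaling. Its graph is a Lagrangian of the orthogonal difference; it is replaced by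
a `B`-stable Lagrangian, which is then moved to the graph of a `B`-linear isometry
(`IsEvenForm.exists_isometry`). -/

theorem Matrix.trace_algEquiv {K : Type u} [Field K] {n m : ℕ}
    (f : Matrix (Fin n) (Fin n) K ≃ₐ[K] Matrix (Fin m) (Fin m) K) (M : Matrix (Fin n) (Fin n) K) :
    Matrix.trace (f M) = Matrix.trace M := by
  let g : Module.End K (Fin n → K) ≃ₐ[K] Module.End K (Fin m → K) :=
    (Matrix.toLinAlgEquiv'.symm.trans f).trans Matrix.toLinAlgEquiv'
  obtain ⟨T, hT⟩ := g.eq_linearEquivConjAlgEquiv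
  have h1 : LinearMap.trace K _ (g (Matrix.toLinAlgEquiv' M)) = Matrix.trace (f M) := by
    have : g (Matrix.toLinAlgEquiv' M) = Matrix.toLin' (f M) := by
      simp [g]; rfl
    rw [this, Matrix.trace_toLin'_eq]
  have h2 : LinearMap.trace K _ (g (Matrix.toLinAlgEquiv' M)) = Matrix.trace M := by
    rw [hT]
    have : (T.conjAlgEquiv K) (Matrix.toLinAlgEquiv' M) = T.conj (Matrix.toLin' M) := rfl
    rw [this, LinearMap.trace_conj', Matrix.trace_toLin'_eq]
  rw [← h1, h2]

/-- The base change of a matrix algebra is a matrix algebra. -/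
noncomputable def matrixBaseChange (F : Type u) (K : Type v) [Field F] [Field K] [Algebra F K]
    (n : ℕ) :
    (K ⊗[F] Matrix (Fin n) (Fin n) F) ≃ₐ[K] Matrix (Fin n) (Fin n) K :=
  AlgEquiv.ofRingEquiv (f := (matrixEquivTensor (Fin n) F K).symm.toRingEquiv) (by
    intro k
    change (matrixEquivTensor (Fin n) F K).symm (k ⊗ₜ[F] 1) = _
    rw [matrixEquivTensor_apply_symm, Algebra.algebraMap_eq_smul_one, Matrix.map_one] <;> simp)

theorem matrixBaseChange_one_tmul (F : Type u) (K : Type v) [Field F] [Field K] [Algebra F K]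
    (n : ℕ) (M : Matrix (Fin n) (Fin n) F) :
    matrixBaseChange F K n (1 ⊗ₜ M) = M.map (algebraMap F K) := by
  change (matrixEquivTensor (Fin n) F K).symm (1 ⊗ₜ[F] M) = _
  rw [matrixEquivTensor_apply_symm, one_smul]

/-- The definition of `reducedTrace` makes a choice, with default `0`. For split `C` the trace over
`F` qualifies: any two splittings over the closure differ by an isomorphism of matrix algebras,
which preserves traces by Skolem–Noether. -/
theorem reducedTrace_eq_trace {C : Type v} [Ring C] [Algebra F C] {V : Type w} [AddCommGroup V]
    [Module F V] [FiniteDimensional F V] (Ψ : C ≃ₐ[F] Module.End F V) (c : C) :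
    reducedTrace F c = LinearMap.trace F V (Ψ c) := by
  let b := Module.finBasis F V
  let M : C ≃ₐ[F] Matrix _ _ F := Ψ.trans (LinearMap.toMatrixAlgEquiv b)
  let Φ := (Algebra.TensorProduct.congr (AlgEquiv.refl (R := AlgebraicClosure F)
    (A₁ := AlgebraicClosure F)) M).trans (matrixBaseChange F _ _)
  have hΦ : Matrix.trace (Φ (1 ⊗ₜ c)) =
      algebraMap F (AlgebraicClosure F) (LinearMap.trace F V (Ψ c)) := by
    have : Φ (1 ⊗ₜ c) = (M c).map (algebraMap F _) := by
      rw [← matrixBaseChange_one_tmul]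
      simp [Φ]
    rw [this, LinearMap.trace_eq_matrix_trace F b]
    exact (AddMonoidHom.map_trace (algebraMap F (AlgebraicClosure F)) (M c)).symm
  have h : IsReducedTrace F c (LinearMap.trace F V (Ψ c)) := by
    intro n Φ'
    rw [← hΦ, ← Matrix.trace_algEquiv (Φ.symm.trans Φ')]
    simp
  have hex : ∃ t : F, IsReducedTrace F c t := ⟨_, h⟩
  rw [reducedTrace, dif_pos hex]
  apply (algebraMap F (AlgebraicClosure F)).injective
  rw [hex.choose_spec _ Φ, hΦ]

end SplitTrace

/-! ### The trace form of a quaternion algebra. -/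

namespace AlgInvolution

variable {F : Type u} [Field F] {B : Type v} [Ring B] [Algebra F B]

theorem apply_one (σ : AlgInvolution F B) : σ 1 = 1 := by
  have h := σ.map_mul_rev (σ 1) 1
  rwa [mul_one, σ.map_map, mul_one, eq_comm] at h

theorem tensor_tmul {A : Type w} [Ring A] [Algebra F A] (σ : AlgInvolution F A)
    (τ : AlgInvolution F B) (a : A) (b : B) : σ.tensor τ (a ⊗ₜ b) = σ a ⊗ₜ τ b := rfl

namespace IsCanonical

variable {τ : AlgInvolution F B}

theorem add_map (hτ : τ.IsCanonical) (x : B) : x + τ x = algebraMap F B (reducedTrace F x) := by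
  rw [hτ x]; abel

/-- The reduced trace of a quaternion algebra as a linear form. -/
noncomputable def traceForm [Nontrivial B] (hτ : τ.IsCanonical) : B →ₗ[F] F where
  toFun := reducedTrace F
  -- Linearity is read off from `x + τ x`, which is the reduced trace of `x` as a scalar of `B`.
  map_add' x y := by
    apply (algebraMap F B).injective
    rw [map_add, ← hτ.add_map, ← hτ.add_map, ← hτ.add_map, map_add]; abel
  map_smul' c x := by
    apply (algebraMap F B).injective
    rw [RingHom.id_apply, smul_eq_mul, map_mul, ← hτ.add_map, ← hτ.add_map, map_smul,
      ← smul_add, Algebra.smul_def]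

variable [Nontrivial B] (hτ : τ.IsCanonical)

theorem algebraMap_traceForm (x : B) : algebraMap F B (hτ.traceForm x) = x + τ x :=
  (hτ.add_map x).symm

theorem traceForm_map (x : B) : hτ.traceForm (τ x) = hτ.traceForm x := by
  apply (algebraMap F B).injective
  rw [algebraMap_traceForm, algebraMap_traceForm, τ.map_map, add_comm]

theorem traceForm_mul_comm (x y : B) : hτ.traceForm (x * y) = hτ.traceForm (y * x) := by
  apply (algebraMap F B).injective
  have hx : τ x = algebraMap F B (hτ.traceForm x) - x := by rw [algebraMap_traceForm]; abel
  have hy : τ y = algebraMap F B (hτ.traceForm y) - y := by rw [algebraMap_traceForm]; abel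
  rw [algebraMap_traceForm, algebraMap_traceForm, τ.map_mul_rev, τ.map_mul_rev, hx, hy]
  have h1 := Algebra.commutes (R := F) (hτ.traceForm x) y
  have h2 := Algebra.commutes (R := F) (hτ.traceForm y) x
  have h3 := Algebra.commutes (R := F) (hτ.traceForm x) (algebraMap F B (hτ.traceForm y))
  simp only [sub_mul, mul_sub, h1, h2, h3]
  abel

/-- If the trace vanished, `τ` would be `-id`. Then `τ 1 = 1` gives `-1 = 1`, so `τ` is the identity
and, reversing products, makes `B` commutative, hence equal to its centre `F`. -/
theorem exists_traceForm_eq_one [Algebra.IsCentral F B] (hB : Module.finrank F B = 4) :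
    ∃ θ, hτ.traceForm θ = 1 := by
  by_contra! hne
  have h0 : ∀ x, hτ.traceForm x = 0 := by
    intro x
    by_contra hx
    apply hne ((hτ.traceForm x)⁻¹ • x)
    rw [map_smul, smul_eq_mul, inv_mul_cancel₀ hx]
  have hneg : ∀ x, τ x = -x := by
    intro x
    have := hτ.algebraMap_traceForm x
    rw [h0, _root_.map_zero] at this
    exact (neg_eq_of_add_eq_zero_right this.symm).symm
  have hone : (-1 : B) = 1 := by rw [← hneg 1, τ.apply_one]
  have hcomm : ∀ x y : B, x * y = y * x := by
    intro x y
    have := τ.map_mul_rev x y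
    rw [hneg, hneg, hneg, neg_mul_neg] at this
    rw [← this, ← neg_one_mul, hone, one_mul]
  have htop : (⊤ : Subalgebra F B) ≤ ⊥ := by
    rw [← Algebra.IsCentral.center_eq_bot F B]
    intro x _
    rw [Subalgebra.mem_center_iff]
    exact fun y => hcomm y x
  have := Subalgebra.finrank_bot (F := F) (E := B)
  rw [top_le_iff.mp htop, subalgebra_top_finrank_eq_submodule_top_finrank, finrank_top] at this
  omega

/-- The trace form `(x, y) ↦ Trd(x y)` is nondegenerate. -/
theorem eq_zero_of_traceForm_mul [Algebra.IsCentral F B] [IsSimpleRing B]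
    (hB : Module.finrank F B = 4) {x : B} (hx : ∀ y, hτ.traceForm (x * y) = 0) : x = 0 := by
  by_contra hne
  -- The radical of the trace form is a two-sided ideal, and it is proper because some trace is 1.
  let I : TwoSidedIdeal B := TwoSidedIdeal.mk' {x | ∀ y, hτ.traceForm (x * y) = 0}
    (by simp) (by intro x y hx hy z; rw [add_mul, map_add, hx, hy, add_zero])
    (by intro x hx z; rw [neg_mul, map_neg, hx, neg_zero])
    (by intro x y hy z; rw [mul_assoc, traceForm_mul_comm, mul_assoc, hy])
    (by intro x y hx z; rw [mul_assoc, hx])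
  have h1 : (1 : B) ∈ I := IsSimpleRing.one_mem_of_ne_zero_mem I (x := x) hne
    ((TwoSidedIdeal.mem_mk' ..).mpr hx)
  obtain ⟨θ, hθ⟩ := hτ.exists_traceForm_eq_one hB
  have := ((TwoSidedIdeal.mem_mk' ..).mp h1) θ
  rw [one_mul, hθ] at this
  exact one_ne_zero this

/-- A linear form on a quaternion algebra that vanishes on commutators is a multiple of the
reduced trace. -/
theorem apply_eq_zero_of_mul_comm [Algebra.IsCentral F B] [IsSimpleRing B] [FiniteDimensional F B]
    (hB : Module.finrank F B = 4) (φ : B →ₗ[F] F) (hφ : ∀ x y, φ (x * y) = φ (y * x))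
    {t : B} (ht : hτ.traceForm t = 0) : φ t = 0 := by
  -- By nondegeneracy `φ` is `y ↦ Trd(z y)` for some `z`; vanishing on commutators makes `z`
  -- central, hence a scalar.
  let D : B →ₗ[F] Module.Dual F B := (LinearMap.mul F B).compr₂ hτ.traceForm
  have hD : ∀ x y, D x y = hτ.traceForm (x * y) := fun _ _ => rfl
  have hinj : Function.Injective D := by
    rw [injective_iff_map_eq_zero]
    intro x hx
    apply hτ.eq_zero_of_traceForm_mul hB
    intro y
    rw [← hD, hx, LinearMap.zero_apply]
  have hsurj : Function.Surjective D :=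
    (LinearMap.injective_iff_surjective_of_finrank_eq_finrank Subspace.dual_finrank_eq.symm).mp hinj
  obtain ⟨z, hz⟩ := hsurj φ
  have hφz : ∀ y, φ y = hτ.traceForm (z * y) := fun y => by rw [← hz, hD]
  have hc : z ∈ Subalgebra.center F B := by
    rw [Subalgebra.mem_center_iff]
    intro y
    rw [← sub_eq_zero]
    apply hτ.eq_zero_of_traceForm_mul hB
    intro w
    rw [sub_mul, map_sub, mul_assoc z y w, ← hφz, hφ, hφz, mul_assoc, traceForm_mul_comm,
      mul_assoc, sub_self]
  rw [Algebra.IsCentral.center_eq_bot, Algebra.mem_bot] at hc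
  obtain ⟨c, rfl⟩ := hc
  rw [hφz, ← Algebra.smul_def, map_smul, ht, smul_zero]

end IsCanonical

end AlgInvolution

/-! ### Multiplications in a central simple algebra and injectivity on tensor products. -/

section Split

variable {F : Type u} [Field F]

/-- Left and right multiplications of a central simple algebra generate all its linear
endomorphisms. -/
theorem mulLeftRight_surjective {B : Type v} [Ring B] [Algebra F B] [Algebra.IsCentral F B]
    [IsSimpleRing B] [FiniteDimensional F B] :
    Function.Surjective (AlgHom.mulLeftRight F B) := by
  -- `R`-submodules of `B` are two-sided ideals, so `B` is a simple `R`-module, and its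
  -- `R`-endomorphisms are the scalars. Jacobson density on a finite basis then gives every linear
  -- map.
  let R := (AlgHom.mulLeftRight F B).range
  have hl : ∀ x : B, LinearMap.mulLeft F x ∈ R := fun x =>
    ⟨x ⊗ₜ 1, by ext y; simp⟩
  have hr : ∀ x : B, LinearMap.mulRight F x ∈ R := fun x =>
    ⟨1 ⊗ₜ MulOpposite.op x, by ext y; simp⟩
  have hsimple : IsSimpleModule R B := by
    rw [isSimpleModule_iff]
    refine { exists_pair_ne := ⟨⊥, ⊤, bot_ne_top⟩, eq_bot_or_eq_top := fun N => ?_ }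
    by_contra! hN
    obtain ⟨x, hxN, hx⟩ := N.ne_bot_iff.mp hN.1
    let I : TwoSidedIdeal B := TwoSidedIdeal.mk' (N : Set B) N.zero_mem N.add_mem (fun {x} hx => by
        have h := N.smul_mem (⟨_, hl (-1)⟩ : R) hx
        change (-1) * x ∈ N at h
        rwa [neg_one_mul] at h)
      (fun {x y} hy => N.smul_mem (⟨_, hl x⟩ : R) hy) (fun {x y} hx => N.smul_mem (⟨_, hr y⟩ : R) hx)
    have h1 : (1 : B) ∈ I := IsSimpleRing.one_mem_of_ne_zero_mem I (x := x) hx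
      ((TwoSidedIdeal.mem_mk' ..).mpr hxN)
    have h1' : (1 : B) ∈ N := (TwoSidedIdeal.mem_mk' ..).mp h1
    apply hN.2
    rw [Submodule.eq_top_iff']
    intro y
    have := N.smul_mem (⟨_, hl y⟩ : R) h1'
    change y * 1 ∈ N at this
    rwa [mul_one] at this
  have hscalar : ∀ g : Module.End R B, ∃ c : F, ∀ x, g x = c • x := by
    intro g
    have h1 : ∀ x y, g (x * y) = x * g y := fun x y => g.map_smul (⟨_, hl x⟩ : R) y
    have h2 : ∀ x y, g (x * y) = g x * y := fun x y => g.map_smul (⟨_, hr y⟩ : R) x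
    have hc : g 1 ∈ Subalgebra.center F B := by
      rw [Subalgebra.mem_center_iff]
      intro y
      rw [← h1, ← h2, one_mul, mul_one]
    rw [Algebra.IsCentral.center_eq_bot, Algebra.mem_bot] at hc
    obtain ⟨c, hc⟩ := hc
    refine ⟨c, fun x => ?_⟩
    rw [Algebra.smul_def, hc, ← h2, one_mul]
  intro f
  let f' : Module.End (Module.End R B) B :=
    { toFun := f
      map_add' := f.map_add
      map_smul' := by
        intro g x
        obtain ⟨c, hc⟩ := hscalar g
        change f (g x) = g (f x)
        rw [hc, hc, map_smul] }
  let b := Module.finBasis F B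
  classical
  obtain ⟨r, hr⟩ := jacobson_density (R := R) f' (Finset.univ.image b)
  obtain ⟨z, hz⟩ := r.2
  refine ⟨z, b.ext fun i => ?_⟩
  have := hr (b i) (Finset.mem_image_of_mem _ (Finset.mem_univ i))
  change (AlgHom.mulLeftRight F B).toRingHom z = _ at hz
  change f (b i) = (r : Module.End F B) (b i) at this
  rw [this, ← hz]
  rfl

/-- An algebra homomorphism defined on `A ⊗ B`, with `B` central simple, is injective if its
restriction to `A` is. -/
theorem injective_of_injective_tmul_one {A B : Type v} [Ring A] [Algebra F A]
    [Ring B] [Algebra F B] [Algebra.IsCentral F B] [IsSimpleRing B] [FiniteDimensional F B]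
    {D : Type w} [Ring D] [Algebra F D] (ρ : A ⊗[F] B →ₐ[F] D)
    (hρ : ∀ a : A, ρ (a ⊗ₜ 1) = 0 → a = 0) : Function.Injective ρ := by
  rw [injective_iff_map_eq_zero]
  intro z hz
  -- The kernel of `ρ` is stable under `id ⊗ f` for every `f`, as these come from multiplication by
  -- `1 ⊗ B`. Coordinate maps into `F · 1` then reduce the claim to `A ⊗ 1`.
  have key : ∀ f : B →ₗ[F] B, ρ (f.lTensor A z) = 0 := by
    intro f
    obtain ⟨w, rfl⟩ := mulLeftRight_surjective (F := F) f
    induction w using TensorProduct.induction_on with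
    | zero => simp
    | add x y hx hy => simp only [map_add, LinearMap.lTensor_add, LinearMap.add_apply, hx, hy,
        add_zero]
    | tmul x y =>
      have : (AlgHom.mulLeftRight F B (x ⊗ₜ y)).lTensor A z =
          (1 ⊗ₜ x) * z * (1 ⊗ₜ y.unop) := by
        clear hz
        induction z using TensorProduct.induction_on with
        | zero => simp
        | add p q hp hq => simp only [map_add, mul_add, add_mul, hp, hq]
        | tmul a b => simp
      rw [this, map_mul, map_mul, hz, mul_zero, zero_mul]
  let b := Module.finBasis F B
  let e := TensorProduct.equivFinsuppOfBasisRight (M := A) b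
  apply e.injective
  rw [_root_.map_zero]
  ext i
  apply hρ
  rw [← key ((b.coord i).smulRight 1)]
  congr 1
  clear key hz
  induction z using TensorProduct.induction_on with
  | zero => simp
  | add p q hp hq => simp only [map_add, Finsupp.add_apply, TensorProduct.add_tmul, hp, hq]
  | tmul x y =>
    rw [LinearMap.lTensor_tmul, LinearMap.smulRight_apply, Module.Basis.coord_apply,
      TensorProduct.equivFinsuppOfBasisRight_apply_tmul_apply, TensorProduct.smul_tmul]

end Split

/-! ### Splitting of `A ⊗ B`. -/

section Split

variable {F : Type u} [Field F]

theorem AlgHom.bijective_of_finrank_eq {C : Type v} {D : Type w} [Ring C] [Algebra F C]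
    [FiniteDimensional F C] [Ring D] [Algebra F D] [FiniteDimensional F D] (f : C →ₐ[F] D)
    (hf : Function.Injective f) (h : Module.finrank F C = Module.finrank F D) :
    Function.Bijective f :=
  ⟨hf, (LinearMap.injective_iff_surjective_of_finrank_eq_finrank (f := f.toLinearMap) h).mp hf⟩

open Matrix in
/-- Matrices over `B` acting on column vectors. -/
def Matrix.mulVecAlgHom (F : Type u) [Field F] (B : Type v) [Ring B] [Algebra F B] (m : ℕ) :
    Matrix (Fin m) (Fin m) B →ₐ[F] Module.End F (Fin m → B) :=
  AlgHom.ofLinearMap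
    { toFun := fun M =>
        { toFun := fun x => M *ᵥ x
          map_add' := fun x y => M.mulVec_add x y
          map_smul' := fun c x => M.mulVec_smul c x }
      map_add' := fun M N => LinearMap.ext fun x => M.add_mulVec N x
      map_smul' := fun c M => LinearMap.ext fun x => M.smul_mulVec c x }
    (LinearMap.ext fun x => Matrix.one_mulVec x)
    (fun M N => LinearMap.ext fun x => (Matrix.mulVec_mulVec x M N).symm)

/-- The action `β • x = x τ(β)` of an algebra with involution on column vectors. -/
def AlgInvolution.vecAlgHom {B : Type v} [Ring B] [Algebra F B] (τ : AlgInvolution F B) (m : ℕ) :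
    B →ₐ[F] Module.End F (Fin m → B) :=
  AlgHom.ofLinearMap
    { toFun := fun β =>
        { toFun := fun x i => x i * τ β
          map_add' := fun x y => by ext i; simp [add_mul]
          map_smul' := fun c x => by ext i; simp }
      map_add' := fun β γ => by ext x i; simp [mul_add]
      map_smul' := fun c β => by ext x i; simp }
    (by ext x i; simp [τ.apply_one])
    (fun β γ => by
      refine LinearMap.ext fun x => funext fun i => ?_
      change x i * τ (β * γ) = x i * τ γ * τ β
      rw [τ.map_mul_rev, mul_assoc])

theorem Matrix.mulVecAlgHom_commute {B : Type v} [Ring B] [Algebra F B] (τ : AlgInvolution F B)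
    (m : ℕ) (M : Matrix (Fin m) (Fin m) B) (β : B) :
    Commute (Matrix.mulVecAlgHom F B m M) (τ.vecAlgHom m β) := by
  refine LinearMap.ext fun x => funext fun i => ?_
  change ∑ j, M i j * (x j * τ β) = (∑ j, M i j * x j) * τ β
  rw [Finset.sum_mul]
  exact Finset.sum_congr rfl fun j _ => (mul_assoc _ _ _).symm

theorem Matrix.mulVecAlgHom_injective {B : Type v} [Ring B] [Algebra F B] (m : ℕ) :
    Function.Injective (Matrix.mulVecAlgHom F B m) := by
  intro M N h
  ext i j
  have := congrFun (LinearMap.congr_fun h (Pi.single j 1)) i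
  change (M.mulVec (Pi.single j 1)) i = (N.mulVec (Pi.single j 1)) i at this
  simpa using this

/-- Through `ψ`, `M_n(A)` acts on `B^m`, commuting with right multiplications, which `τ` turns into
a left action of `B`. The corner `V` cut out by the first diagonal matrix unit carries commuting
actions of `A` and `B`. The map from `A ⊗ B` is injective, and dimensions agree because `B^m` is
`V^n`. -/
theorem BrauerEquiv.exists_algEquiv_end {A B : Type v}
    [Ring A] [Algebra F A] [Algebra.IsCentral F A] [IsSimpleRing A] [FiniteDimensional F A]
    [Ring B] [Algebra F B] [Algebra.IsCentral F B] [IsSimpleRing B] [FiniteDimensional F B]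
    (h : BrauerEquiv F A B) (τ : AlgInvolution F B) :
    ∃ (V : Type v) (_ : AddCommGroup V) (_ : Module F V) (_ : FiniteDimensional F V),
      Nonempty (A ⊗[F] B ≃ₐ[F] Module.End F V) := by
  obtain ⟨n, m, hn, hm, ⟨ψ'⟩⟩ := h
  have ψ : Matrix (Fin n) (Fin n) A ≃ₐ[F] Matrix (Fin m) (Fin m) B := ψ'
  have : NeZero n := ⟨hn⟩
  let L : Matrix (Fin n) (Fin n) A →ₐ[F] Module.End F (Fin m → B) :=
    (Matrix.mulVecAlgHom F B m).comp ψ.toAlgHom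
  have hLinj : Function.Injective L := (Matrix.mulVecAlgHom_injective m).comp ψ.injective
  have hcomm : ∀ M β, Commute (L M) (τ.vecAlgHom m β) := fun M β =>
    Matrix.mulVecAlgHom_commute τ m (ψ M) β
  let s : Fin n → Fin n → A → Module.End F (Fin m → B) := fun i j a => L (Matrix.single i j a)
  have hs : ∀ i j k a b x, s i j a (s j k b x) = s i k (a * b) x := by
    intro i j k a b x
    change (L _ * L _) x = _
    rw [← map_mul, Matrix.single_mul_single_same]
  have hs' : ∀ i j k l a b x, j ≠ k → s i j a (s k l b x) = 0 := by
    intro i j k l a b x hjk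
    change (L _ * L _) x = _
    rw [← map_mul, Matrix.single_mul_single_of_ne (h := hjk), map_zero, LinearMap.zero_apply]
  let V : Submodule F (Fin m → B) := LinearMap.range (s 0 0 1)
  have hV : ∀ x ∈ V, s 0 0 1 x = x := by
    rintro _ ⟨x, rfl⟩
    rw [hs, one_mul]
  have hmem : ∀ i a x, s 0 i a x ∈ V := by
    intro i a x
    refine ⟨s 0 i a x, ?_⟩
    rw [hs, one_mul]
  have hBV : ∀ β, ∀ x ∈ V, τ.vecAlgHom m β x ∈ V := by
    rintro β _ ⟨x, rfl⟩
    refine ⟨τ.vecAlgHom m β x, ?_⟩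
    exact LinearMap.congr_fun (hcomm _ β) x
  let ρA : A →ₐ[F] Module.End F V := AlgHom.ofLinearMap
    { toFun := fun a => (s 0 0 a).restrict (fun x _ => hmem 0 a x)
      map_add' := by
        intro a b
        refine LinearMap.ext fun x => Subtype.ext ?_
        change L (Matrix.single 0 0 (a + b)) x = L (Matrix.single 0 0 a) x + L (Matrix.single 0 0 b) x
        rw [Matrix.single_add, map_add, LinearMap.add_apply]
      map_smul' := by
        intro c a
        refine LinearMap.ext fun x => Subtype.ext ?_
        change L (Matrix.single 0 0 (c • a)) x = c • L (Matrix.single 0 0 a) x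
        rw [← Matrix.smul_single, map_smul, LinearMap.smul_apply] }
    (LinearMap.ext fun x => Subtype.ext (hV x x.2))
    (fun a b => LinearMap.ext fun x => Subtype.ext (hs 0 0 0 a b x).symm)
  let ρB : B →ₐ[F] Module.End F V := AlgHom.ofLinearMap
    { toFun := fun β => (τ.vecAlgHom m β).restrict (hBV β)
      map_add' := fun β γ => LinearMap.ext fun x => Subtype.ext (by
        change τ.vecAlgHom m (β + γ) x = τ.vecAlgHom m β x + τ.vecAlgHom m γ x
        rw [map_add, LinearMap.add_apply])
      map_smul' := fun c β => LinearMap.ext fun x => Subtype.ext (by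
        change τ.vecAlgHom m (c • β) x = c • τ.vecAlgHom m β x
        rw [map_smul, LinearMap.smul_apply]) }
    (LinearMap.ext fun x => Subtype.ext (by
      change τ.vecAlgHom m 1 x = x
      rw [map_one, Module.End.one_apply]))
    (fun β γ => LinearMap.ext fun x => Subtype.ext (by
      change τ.vecAlgHom m (β * γ) x = τ.vecAlgHom m β (τ.vecAlgHom m γ x)
      rw [map_mul, Module.End.mul_apply]))
  let ρ : A ⊗[F] B →ₐ[F] Module.End F V := Algebra.TensorProduct.lift ρA ρB (fun a β =>
    LinearMap.ext fun x => Subtype.ext (LinearMap.congr_fun (hcomm (Matrix.single 0 0 a) β) x))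
  have hρ : Function.Injective ρ := by
    refine injective_of_injective_tmul_one (D := Module.End F V) ρ ?_
    intro a ha
    have ha' : ρA a = 0 := by
      have h1 : ρ (a ⊗ₜ 1) = ρA a * ρB 1 := Algebra.TensorProduct.lift_tmul ..
      rw [← ha, h1, map_one]
      exact (mul_one (ρA a)).symm
    have h0 : L (Matrix.single 0 0 a) = 0 := by
      refine LinearMap.ext fun x => ?_
      have := congrArg Subtype.val (LinearMap.congr_fun ha' ⟨_, hmem 0 1 x⟩)
      change s 0 0 a (s 0 0 1 x) = 0 at this
      rwa [hs, mul_one] at this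
    have h1 := hLinj (h0.trans (map_zero L).symm)
    simpa using congrFun (congrFun h1 0) 0
  let e : (Fin m → B) ≃ₗ[F] (Fin n → V) :=
    { toFun := fun x i => ⟨s 0 i 1 x, hmem i 1 x⟩
      map_add' := fun x y => funext fun i => Subtype.ext (map_add _ _ _)
      map_smul' := fun c x => funext fun i => Subtype.ext (map_smul _ _ _)
      invFun := fun y => ∑ i, s i 0 1 (y i)
      left_inv := by
        intro x
        change ∑ i, s i 0 1 (s 0 i 1 x) = x
        simp only [hs, one_mul]
        rw [← LinearMap.sum_apply, ← map_sum]
        have : ∑ i : Fin n, Matrix.single i i (1 : A) = 1 := by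
          exact Matrix.sum_single_one
        rw [this, map_one, Module.End.one_apply]
      right_inv := by
        intro y
        funext i
        apply Subtype.ext
        change s 0 i 1 (∑ j, s j 0 1 (y j)) = y i
        rw [map_sum, Finset.sum_eq_single i]
        · rw [hs, one_mul, hV _ (y i).2]
        · intro j _ hj
          exact hs' _ _ _ _ _ _ _ hj.symm
        · simp }
  have hdim1 : m * Module.finrank F B = n * Module.finrank F V := by
    have := e.finrank_eq
    rw [Module.finrank_pi_fintype, Module.finrank_pi_fintype] at this
    simpa using this
  have hdim2 : n * n * Module.finrank F A = m * m * Module.finrank F B := by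
    have := ψ.toLinearEquiv.finrank_eq
    simpa [Module.finrank_matrix] using this
  have hdim : Module.finrank F (A ⊗[F] B) = Module.finrank F (Module.End F V) := by
    rw [Module.finrank_tensorProduct, Module.finrank_linearMap]
    have hn0 : 0 < n * n := Nat.mul_pos (Nat.pos_of_ne_zero hn) (Nat.pos_of_ne_zero hn)
    apply Nat.eq_of_mul_eq_mul_left hn0
    calc n * n * (Module.finrank F A * Module.finrank F B)
        = (n * n * Module.finrank F A) * Module.finrank F B := by ring
      _ = (m * Module.finrank F B) * (m * Module.finrank F B) := by rw [hdim2]; ring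
      _ = _ := by rw [hdim1]; ring
  refine ⟨V, inferInstance, inferInstance, inferInstance, 
    ⟨AlgEquiv.ofBijective ρ (AlgHom.bijective_of_finrank_eq (D := Module.End F V) ρ hρ hdim)⟩⟩

end Split

/-! ### Bilinear forms adjoint to an involution of a split algebra. -/

section AdjointForm

variable {F : Type u} [Field F] {V : Type w} [AddCommGroup V] [Module F V] [FiniteDimensional F V]
  {C : Type v} [Ring C] [Algebra F C]

open LinearMap (BilinForm)

/-- The action of `C` on the dual space that is contragredient with respect to `J`. -/
def AlgInvolution.dualAlgHom (J : AlgInvolution F C) (Ψ : C ≃ₐ[F] Module.End F V) :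
    C →ₐ[F] Module.End F (Module.Dual F V) :=
  AlgHom.ofLinearMap (Module.Dual.transpose ∘ₗ Ψ.toLinearMap ∘ₗ J.toLin)
    (by
      refine LinearMap.ext fun φ => LinearMap.ext fun x => ?_
      change φ (Ψ (J 1) x) = φ x
      rw [J.apply_one, _root_.map_one, Module.End.one_apply])
    (fun c d => by
      refine LinearMap.ext fun φ => LinearMap.ext fun x => ?_
      change φ (Ψ (J (c * d)) x) = φ (Ψ (J d) (Ψ (J c) x))
      rw [J.map_mul_rev, map_mul, Module.End.mul_apply])

omit [FiniteDimensional F V] in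
theorem AlgInvolution.dualAlgHom_apply (J : AlgInvolution F C) (Ψ : C ≃ₐ[F] Module.End F V)
    (c : C) (φ : Module.Dual F V) (x : V) : J.dualAlgHom Ψ c φ x = φ (Ψ (J c) x) := rfl

/-- `C` acts on `V` and, through `J`, on the dual of `V`, each time as the full endomorphism
algebra. By Skolem–Noether an isomorphism from `V` to its dual intertwines the two actions; it is
the form. -/
theorem AlgInvolution.exists_adjoint_form (J : AlgInvolution F C) (Ψ : C ≃ₐ[F] Module.End F V) :
    ∃ b : BilinForm F V, b.Nondegenerate ∧ ∀ c x y, b (Ψ c x) y = b x (Ψ (J c) y) := by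
  have : FiniteDimensional F C := FiniteDimensional.of_injective Ψ.toLinearMap Ψ.injective
  obtain ⟨f, hf⟩ : ∃ f : C →ₐ[F] Module.End F (Module.Dual F V), ∀ c φ x, f c φ x = φ (Ψ (J c) x) :=
    ⟨J.dualAlgHom Ψ, J.dualAlgHom_apply Ψ⟩
  have hinj : Function.Injective f := by
    rw [injective_iff_map_eq_zero]
    intro c hc
    have h0 : Ψ (J c) = 0 := by
      ext x
      apply (Module.forall_dual_apply_eq_zero_iff F _).mp
      intro φ
      rw [← hf, hc]; rfl
    rw [← J.map_map c, (map_eq_zero_iff Ψ Ψ.injective).mp h0, _root_.map_zero]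
  have hdim : Module.finrank F C = Module.finrank F (Module.End F (Module.Dual F V)) := by
    rw [Ψ.toLinearEquiv.finrank_eq, Module.finrank_linearMap, Module.finrank_linearMap,
      Subspace.dual_finrank_eq]
  have hex : ∃ e : Module.End F V ≃ₐ[F] Module.End F (Module.Dual F V), ∀ c, e (Ψ c) = f c := by
    have hbij : Function.Bijective f :=
      AlgHom.bijective_of_finrank_eq (D := Module.End F (Module.Dual F V)) f hinj hdim
    refine ⟨Ψ.symm.trans (AlgEquiv.ofBijective f hbij), ?_⟩
    intro c
    rw [AlgEquiv.trans_apply, AlgEquiv.symm_apply_apply, AlgEquiv.ofBijective_apply]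
  obtain ⟨e, h2⟩ := hex
  obtain ⟨g, hg⟩ := e.eq_linearEquivConjAlgEquiv
  let b : BilinForm F V := g.toLinearMap
  have hb : ∀ x y, b x y = g x y := fun _ _ => rfl
  clear_value b
  refine ⟨b, ⟨fun x hx => ?_, fun x hx => ?_⟩, fun c x y => ?_⟩
  · apply g.injective
    rw [_root_.map_zero]
    refine LinearMap.ext fun y => ?_
    rw [← hb, hx]; rfl
  · apply (Module.forall_dual_apply_eq_zero_iff F _).mp
    intro φ
    rw [← g.apply_symm_apply φ]
    rw [← hb, hx]
  · have h1 : e (Ψ c) (g x) = g (Ψ c x) := by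
      rw [hg, LinearEquiv.conjAlgEquiv_apply]
      simp
    rw [hb, hb, ← h1, h2, hf]

theorem AlgInvolution.adjoint_form_unique (J : AlgInvolution F C) (Ψ : C ≃ₐ[F] Module.End F V)
    {b b' : BilinForm F V} (hb : b.Nondegenerate)
    (hbJ : ∀ c x y, b (Ψ c x) y = b x (Ψ (J c) y))
    (hbJ' : ∀ c x y, b' (Ψ c x) y = b' x (Ψ (J c) y)) : ∃ c : F, ∀ x y, b' x y = c * b x y := by
  let g := b'.symmCompOfNondegenerate b hb
  have hg : ∀ x y, b (g x) y = b' x y := fun x y => by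
    rw [BilinForm.comp_symmCompOfNondegenerate_apply b' hb]
  have hc : g ∈ Subalgebra.center F (Module.End F V) := by
    rw [Subalgebra.mem_center_iff]
    intro X
    obtain ⟨c, rfl⟩ := Ψ.surjective X
    refine LinearMap.ext fun x => ?_
    rw [← sub_eq_zero]
    apply hb.1
    intro y
    rw [map_sub, LinearMap.sub_apply, Module.End.mul_apply, Module.End.mul_apply, hbJ, hg, hg,
      hbJ', sub_self]
  rw [Algebra.IsCentral.center_eq_bot, Algebra.mem_bot] at hc
  obtain ⟨c, hc⟩ := hc
  refine ⟨c, fun x y => ?_⟩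
  rw [← hg, ← hc, Module.algebraMap_end_apply, map_smul, LinearMap.smul_apply, smul_eq_mul]

/-- The flipped form is also adjoint to `J`, so it is `c b`; flipping twice gives `c² = 1`. -/
theorem AlgInvolution.adjoint_form_symm_or_skew [Nontrivial V] (J : AlgInvolution F C)
    (Ψ : C ≃ₐ[F] Module.End F V) {b : BilinForm F V} (hb : b.Nondegenerate)
    (hbJ : ∀ c x y, b (Ψ c x) y = b x (Ψ (J c) y)) :
    (∀ x y, b x y = b y x) ∨ ∀ x y, b x y = -b y x := by
  obtain ⟨c, hc⟩ := J.adjoint_form_unique Ψ (b' := b.flip) hb hbJ (by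
    intro c x y
    rw [BilinForm.flip_apply, BilinForm.flip_apply, hbJ, J.map_map])
  simp only [BilinForm.flip_apply] at hc
  have hne : ∃ x y, b x y ≠ 0 := by
    obtain ⟨x, hx⟩ := exists_ne (0 : V)
    by_contra! h
    exact hx (hb.1 x (h x))
  obtain ⟨x, y, hxy⟩ := hne
  have h2 : c * c = 1 := by
    have := hc x y
    rw [hc] at this
    apply mul_right_cancel₀ hxy
    have h3 := hc y x
    rw [hc x y, ← mul_assoc] at h3
    rw [one_mul, ← h3]
  rcases mul_self_eq_one_iff.mp h2 with rfl | rfl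
  · left; intro x y; rw [hc, one_mul]
  · right; intro x y; rw [hc y x]; ring

theorem two_mul_finrank_lt_of_skew [Nontrivial V] (h2 : (2 : F) ≠ 0)
    (Ψ : C ≃ₐ[F] Module.End F V) {b : BilinForm F V} (hb : b.Nondegenerate)
    (hskew : ∀ x y, b x y = -b y x) (S : Submodule F C)
    (hS : ∀ c ∈ S, ∀ x y, b (Ψ c x) y = b x (Ψ c y)) :
    2 * Module.finrank F S < Module.finrank F C := by
  have : FiniteDimensional F C := FiniteDimensional.of_injective Ψ.toLinearMap Ψ.injective
  let e := Module.finBasis F V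
  let n := Module.finrank F V
  have hanti : ∀ c ∈ S, ∀ i j, b (Ψ c (e i)) (e j) = -b (Ψ c (e j)) (e i) := by
    intro c hc i j
    rw [hS c hc, hskew]
  have hdiag : ∀ c ∈ S, ∀ i, b (Ψ c (e i)) (e i) = 0 := by
    intro c hc i
    have := hanti c hc i i
    rw [eq_neg_iff_add_eq_zero, ← two_mul] at this
    exact (mul_eq_zero.mp this).resolve_left h2
  have hzero : ∀ c ∈ S, (∀ i j, i < j → b (Ψ c (e i)) (e j) = 0) → c = 0 := by
    intro c hc h
    apply (map_eq_zero_iff Ψ Ψ.injective).mp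
    refine e.ext fun i => hb.1 _ fun y => ?_
    have : b (Ψ c (e i)) = 0 := by
      refine e.ext fun j => ?_
      rcases lt_trichotomy i j with hij | rfl | hij
      · exact h i j hij
      · exact hdiag c hc i
      · rw [hanti c hc, h j i hij, neg_zero]; rfl
    rw [this]; rfl
  -- For `c` in `S` the form `b(cx, y)` is alternating, so its strict upper triangle determines `c`.
  -- Two copies of `S` fill the two triangles and one scalar the diagonal: `2 dim S + 1 ≤ n²`.
  let f : (S × S × F) →ₗ[F] Matrix (Fin n) (Fin n) F :=
    { toFun := fun p => Matrix.of fun i j =>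
        if i < j then b (Ψ p.1 (e i)) (e j) else if j < i then b (Ψ p.2.1 (e j)) (e i) else p.2.2
      map_add' := by
        intro p q
        ext i j
        simp only [Matrix.of_apply, Matrix.add_apply]
        split_ifs <;> simp
      map_smul' := by
        intro c p
        ext i j
        simp only [Matrix.of_apply, Matrix.smul_apply]
        split_ifs <;> simp }
  have hf : Function.Injective f := by
    rw [injective_iff_map_eq_zero]
    rintro ⟨c, d, t⟩ h
    have h' : ∀ i j, (if i < j then b (Ψ c (e i)) (e j) else if j < i then b (Ψ d (e j)) (e i)
      else t) = 0 := fun i j => congrFun (congrFun h i) j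
    have hn : 0 < n := Module.finrank_pos
    refine Prod.ext (Subtype.ext (hzero c c.2 fun i j hij => ?_))
      (Prod.ext (Subtype.ext (hzero d d.2 fun i j hij => ?_)) ?_)
    · simpa [hij] using h' i j
    · simpa [hij, hij.not_gt] using h' j i
    · simpa using h' ⟨0, hn⟩ ⟨0, hn⟩
  have h1 := LinearMap.finrank_le_finrank_of_injective hf
  rw [Module.finrank_prod, Module.finrank_prod, Module.finrank_self, Module.finrank_matrix,
    Fintype.card_fin, Module.finrank_self] at h1
  rw [Ψ.toLinearEquiv.finrank_eq, Module.finrank_linearMap]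
  change _ < n * n
  lia

/-- The adjoint involution of a nondegenerate alternating form takes some `z` to `1 - z`. -/
theorem LinearMap.BilinForm.IsAlt.exists_end {b : BilinForm F V} (hb : b.Nondegenerate)
    (halt : b.IsAlt) :
    ∃ X : Module.End F V, ∀ x y, b (X x) y + b x (X y) = b x y := by
  let e := Module.finBasis F V
  -- `q` is the strict upper triangle of `b`, so `b = q - q.flip`. The map `X` representing `q` by
  -- `b` plays the part of `1/2`, also in characteristic two.
  let q : BilinForm F V := e.constr F (fun i => e.constr F (fun j =>
    if i < j then b (e i) (e j) else 0))
  have hq : ∀ i j, q (e i) (e j) = if i < j then b (e i) (e j) else 0 := by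
    intro i j
    simp only [q, Module.Basis.constr_basis]
  have hbq : b = q - q.flip := by
    refine LinearMap.BilinForm.ext_basis e fun i j => ?_
    rw [LinearMap.sub_apply, LinearMap.sub_apply, BilinForm.flip_apply, hq, hq]
    rcases lt_trichotomy i j with hij | rfl | hij
    · simp [hij, hij.not_gt]
    · simpa using halt (e i)
    · simpa [hij, hij.not_gt] using (halt.neg_eq (x := e j) (y := e i)).symm
  let X := q.symmCompOfNondegenerate b hb
  have hX : ∀ x y, b (X x) y = q x y := fun x y => by
    rw [BilinForm.comp_symmCompOfNondegenerate_apply q hb]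
  refine ⟨X, fun x y => ?_⟩
  rw [← halt.neg_eq (x := X y) (y := x), hX, hX, hbq]
  simp [BilinForm.flip_apply, sub_eq_add_neg]

end AdjointForm

/-! ### Consequences of symplecticity. -/

namespace AlgInvolution.IsSymplectic

variable {F : Type u} [Field F] {A : Type v} [Ring A] [Algebra F A]
  {σ : AlgInvolution F A}

theorem exists_add_map_eq_one (hσ : σ.IsSymplectic) : ∃ a, a + σ a = 1 := by
  obtain ⟨K, _, _, W, _, _, _, b, Φ, halt, hb, hadj⟩ := hσ
  obtain ⟨X, hX⟩ := LinearMap.BilinForm.IsAlt.exists_end hb halt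
  let g : A →ₗ[F] A := LinearMap.id + σ.toLin
  have hz : g.baseChange K (Φ.symm X) = 1 := by
    apply Φ.injective
    refine LinearMap.ext fun y => ?_
    rw [← sub_eq_zero]
    apply hb.2
    intro x
    rw [LinearMap.baseChange_add, LinearMap.baseChange_id, LinearMap.add_apply, LinearMap.id_apply,
      map_add, _root_.map_one, map_sub, LinearMap.add_apply, map_add, ← hadj, Φ.apply_symm_apply,
      Module.End.one_apply, add_comm, hX, sub_self]
  -- Descent from `K` to `F`: a linear form that kills the image of `id + σ` but not `1` would,
  -- after base change, kill `1`.
  by_contra! hne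
  have hmem : (1 : A) ∉ LinearMap.range g := by
    rintro ⟨a, ha⟩
    exact hne a ha
  obtain ⟨φ, hφ1, hφ⟩ := Submodule.exists_le_ker_of_notMem hmem
  have h0 : φ ∘ₗ g = 0 := LinearMap.ext fun x => hφ ⟨x, rfl⟩
  have h1 : (φ.baseChange K) (1 : K ⊗[F] A) = 0 := by
    rw [← hz, ← LinearMap.comp_apply, ← LinearMap.baseChange_comp, h0, LinearMap.baseChange_zero,
      LinearMap.zero_apply]
  rw [Algebra.TensorProduct.one_def, LinearMap.baseChange_tmul] at h1
  have h2 := congrArg (TensorProduct.rid F K) h1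
  rw [TensorProduct.rid_tmul, _root_.map_zero, smul_eq_zero] at h2
  exact h2.elim hφ1 one_ne_zero

theorem two_mul_finrank_sym_lt [Nontrivial A] [FiniteDimensional F A] (hσ : σ.IsSymplectic)
    (h2 : (2 : F) ≠ 0) : 2 * Module.finrank F σ.sym < Module.finrank F A := by
  obtain ⟨K, _, _, W, _, _, _, b, Φ, halt, hb, hadj⟩ := hσ
  have : Nontrivial W := by
    by_contra h
    rw [not_nontrivial_iff_subsingleton] at h
    have h1 : Nontrivial (K ⊗[F] A) := inferInstance
    exact not_subsingleton _ (Φ.toEquiv.subsingleton)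
  have h2K : (2 : K) ≠ 0 := by
    rw [← map_ofNat (algebraMap F K) 2]
    exact (map_ne_zero _).mpr h2
  let ι := σ.sym.subtype.baseChange K
  have hι : Function.Injective ι :=
    Module.Flat.lTensor_preserves_injective_linearMap _ σ.sym.injective_subtype
  have hσι : ∀ z, σ.toLin.baseChange K (ι z) = ι z := by
    intro z
    rw [← LinearMap.comp_apply, ← LinearMap.baseChange_comp]
    congr 2
    exact LinearMap.ext fun s => s.2
  have key := two_mul_finrank_lt_of_skew h2K Φ hb
    (fun x y => (halt.neg_eq (x := y) (y := x)).symm) (LinearMap.range ι) (by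
      rintro _ ⟨z, rfl⟩ x y
      rw [hadj, hσι])
  rwa [LinearMap.finrank_range_of_inj hι, Module.finrank_baseChange, Module.finrank_baseChange]
    at key

end AlgInvolution.IsSymplectic

/-! ### Hermitian models. -/

section Model

variable {F : Type u} [Field F] {A B : Type v} [Ring A] [Algebra F A] [Ring B] [Algebra F B]

namespace AlgInvolution

/-- `Sym(σ) ⊗ 1` and the tensors of elements `a - σ(a)` with the three-dimensional space of
trace-zero elements are both fixed by `σ ⊗ τ`, the latter being products of two skew factors. -/
theorem finrank_sym_tensor_ge [FiniteDimensional F A] [FiniteDimensional F B] [Nontrivial B]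
    [Algebra.IsCentral F B] (h2 : (2 : F) ≠ 0) (σ : AlgInvolution F A) {τ : AlgInvolution F B}
    (hτ : τ.IsCanonical) (hB : Module.finrank F B = 4) :
    3 * Module.finrank F A ≤ Module.finrank F (σ.tensor τ).sym + 2 * Module.finrank F σ.sym := by
  let T := hτ.traceForm
  let d : A →ₗ[F] A := LinearMap.id - σ.toLin
  let D := LinearMap.range d
  let B₀ := LinearMap.ker T
  have hker : LinearMap.ker d = σ.sym := by
    ext x
    rw [LinearMap.mem_ker, LinearMap.sub_apply, sub_eq_zero, eq_comm, mem_sym]; rfl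
  have hD : Module.finrank F D + Module.finrank F σ.sym = Module.finrank F A := by
    rw [← hker]; exact d.finrank_range_add_finrank_ker
  have hB₀ : Module.finrank F B₀ = 3 := by
    have h := T.finrank_range_add_finrank_ker
    have hsurj : Function.Surjective T := by
      obtain ⟨θ, hθ⟩ := hτ.exists_traceForm_eq_one hB
      exact fun c => ⟨c • θ, by rw [map_smul, hθ, smul_eq_mul, mul_one]⟩
    rw [LinearMap.range_eq_top.mpr hsurj, finrank_top, Module.finrank_self, hB] at h
    change 1 + Module.finrank F B₀ = 4 at h
    omega
  let m : D ⊗[F] B₀ →ₗ[F] A ⊗[F] B := TensorProduct.map D.subtype B₀.subtype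
  have hm : Function.Injective m :=
    TensorProduct.map_injective_of_flat_flat _ _ D.injective_subtype B₀.injective_subtype
  let i : σ.sym →ₗ[F] A ⊗[F] B := (TensorProduct.mk F A B).flip 1 ∘ₗ σ.sym.subtype
  let f : (σ.sym × (D ⊗[F] B₀)) →ₗ[F] A ⊗[F] B := i.coprod m
  have hf : Function.Injective f := by
    rw [injective_iff_map_eq_zero]
    rintro ⟨s, z⟩ h
    have hsz : (s : A) ⊗ₜ[F] (1 : B) + m z = 0 := h
    -- `id ⊗ Trd` shows independence: it kills the second summand and is multiplication by 2 on `s ⊗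
    -- 1`.
    let R : A ⊗[F] B →ₗ[F] A := (TensorProduct.rid F A).toLinearMap ∘ₗ T.lTensor A
    have hRm : R ∘ₗ m = 0 := by
      refine TensorProduct.ext' fun x y => ?_
      change (TensorProduct.rid F A) ((x : A) ⊗ₜ T y) = 0
      rw [show T y = 0 from y.2, TensorProduct.tmul_zero, _root_.map_zero]
    have hT1 : T 1 = 2 := by
      apply (algebraMap F B).injective
      rw [hτ.algebraMap_traceForm, τ.apply_one, one_add_one_eq_two, map_ofNat]
    have h3 := congrArg R hsz
    rw [map_add, ← LinearMap.comp_apply, hRm, LinearMap.zero_apply, add_zero, _root_.map_zero] at h3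
    change (TensorProduct.rid F A) ((s : A) ⊗ₜ T 1) = 0 at h3
    rw [TensorProduct.rid_tmul, hT1, smul_eq_zero] at h3
    have hs : s = 0 := Subtype.ext (h3.resolve_left h2)
    refine Prod.ext hs ?_
    rw [hs] at hsz
    apply hm
    simpa using hsz
  have hrange : LinearMap.range f ≤ (σ.tensor τ).sym := by
    rw [LinearMap.range_coprod, sup_le_iff]
    constructor
    · rintro _ ⟨s, rfl⟩
      exact tmul_mem_sym s.2 τ.apply_one
    · rintro _ ⟨z, rfl⟩
      induction z using TensorProduct.induction_on with
      | zero => rw [_root_.map_zero]; exact Submodule.zero_mem _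
      | add x y hx hy => rw [map_add]; exact Submodule.add_mem _ hx hy
      | tmul x y =>
        obtain ⟨_, a, rfl⟩ := x
        have hy : τ (y : B) = -y := by
          have := hτ.algebraMap_traceForm (y : B)
          rw [show hτ.traceForm y = 0 from y.2, _root_.map_zero] at this
          exact (neg_eq_of_add_eq_zero_right this.symm).symm
        have ha : σ (d a) = -d a := by
          change σ (a - σ a) = -(a - σ a)
          rw [map_sub, σ.map_map, neg_sub]
        change σ (d a) ⊗ₜ[F] τ (y : B) = d a ⊗ₜ[F] (y : B)
        rw [ha, hy, TensorProduct.neg_tmul, TensorProduct.tmul_neg, neg_neg]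
  have := Submodule.finrank_mono hrange
  rw [LinearMap.finrank_range_of_inj hf, Module.finrank_prod, Module.finrank_tensorProduct,
    hB₀] at this
  omega

end AlgInvolution

/-- A representation of `A ⊗ B` as the algebra of all endomorphisms of a vector space `V`, in
which `σ ⊗ τ` is adjoint to a symmetric bilinear form. -/
structure HermitianModel (σ : AlgInvolution F A) (τ : AlgInvolution F B) (V : Type w)
    [AddCommGroup V] [Module F V] [Module B V] where
  rep : A ⊗[F] B ≃ₐ[F] Module.End F V
  rep_one_tmul : ∀ (β : B) (x : V), rep (1 ⊗ₜ β) x = β • x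
  form : LinearMap.BilinForm F V
  nondegenerate : form.Nondegenerate
  symm : ∀ x y, form x y = form y x
  form_rep : ∀ c x y, form (rep c x) y = form x (rep (σ.tensor τ c) y)

theorem exists_hermitianModel [Algebra.IsCentral F A] [IsSimpleRing A] [FiniteDimensional F A]
    [Algebra.IsCentral F B] [IsSimpleRing B] [FiniteDimensional F B]
    (hB : Module.finrank F B = 4) {τ : AlgInvolution F B} (hτ : τ.IsCanonical)
    {σ : AlgInvolution F A} (hσ : σ.IsSymplectic) (hA : BrauerEquiv F A B) :
    ∃ (V : Type v) (_ : AddCommGroup V) (_ : Module F V) (_ : Module B V)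
      (_ : IsScalarTower F B V) (_ : FiniteDimensional F V), Nonempty (HermitianModel σ τ V) := by
  obtain ⟨V, _, _, _, ⟨Ψ⟩⟩ := hA.exists_algEquiv_end τ
  let ρ : B →ₐ[F] Module.End F V := Ψ.toAlgHom.comp Algebra.TensorProduct.includeRight
  let _ : Module B V := Module.compHom V ρ.toRingHom
  have hsmul : ∀ (β : B) (x : V), Ψ (1 ⊗ₜ β) x = β • x := fun _ _ => rfl
  have : IsScalarTower F B V := ⟨fun c β x => by
    rw [← hsmul, ← hsmul, TensorProduct.tmul_smul, map_smul, LinearMap.smul_apply]⟩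
  have : Nontrivial V := by
    by_contra h
    rw [not_nontrivial_iff_subsingleton] at h
    exact not_subsingleton (A ⊗[F] B) (Ψ.toEquiv.subsingleton)
  obtain ⟨b, hb, hbJ⟩ := (σ.tensor τ).exists_adjoint_form Ψ
  refine ⟨V, inferInstance, inferInstance, inferInstance, inferInstance, inferInstance,
    ⟨⟨Ψ, hsmul, b, hb, ?_, hbJ⟩⟩⟩
  rcases (σ.tensor τ).adjoint_form_symm_or_skew Ψ hb hbJ with h | h
  · exact h
  by_cases h2 : (2 : F) = 0
  · intro x y
    have : (1 : F) + 1 = 0 := by rw [one_add_one_eq_two, h2]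
    rw [h x y, neg_eq_iff_add_eq_zero, ← two_mul, h2, zero_mul]
  -- A skew form would give `dim Sym(σ ⊗ τ) < 2 dim A`, whereas it is at least `3 dim A - 2 dim
  -- Sym(σ) > 2 dim A`.
  · exfalso
    have h1 := two_mul_finrank_lt_of_skew h2 Ψ hb h (σ.tensor τ).sym (by
      intro c hc x y
      rw [hbJ, AlgInvolution.mem_sym.mp hc])
    have h3 := AlgInvolution.finrank_sym_tensor_ge h2 σ hτ hB
    have h4 := hσ.two_mul_finrank_sym_lt h2
    rw [Module.finrank_tensorProduct, hB] at h1
    omega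

namespace HermitianModel

variable {σ : AlgInvolution F A} {τ : AlgInvolution F B} {V : Type w}
  [AddCommGroup V] [Module F V] [Module B V] (M : HermitianModel σ τ V)

theorem rep_tmul_one_smul (a : A) (β : B) (x : V) :
    M.rep (a ⊗ₜ 1) (β • x) = β • M.rep (a ⊗ₜ 1) x := by
  rw [← M.rep_one_tmul, ← M.rep_one_tmul, ← Module.End.mul_apply, ← Module.End.mul_apply,
    ← map_mul, ← map_mul]
  simp

theorem form_rep_tmul_one (a : A) (x y : V) :
    M.form (M.rep (a ⊗ₜ 1) x) y = M.form x (M.rep (σ a ⊗ₜ 1) y) := by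
  rw [M.form_rep, AlgInvolution.tensor_tmul, τ.apply_one]

theorem form_smul (β : B) (x y : V) : M.form (β • x) y = M.form x (τ β • y) := by
  rw [← M.rep_one_tmul, M.form_rep, AlgInvolution.tensor_tmul, σ.apply_one, M.rep_one_tmul]

/-- Write `x = ax + σ(a)x`. The two contributions to `b(x, βx)` cancel, because `β` is skew and
commutes with `A`. -/
theorem form_self_smul (hσ : ∃ a, a + σ a = 1) {β : B} (hβ : τ β = -β) (x : V) :
    M.form x (β • x) = 0 := by
  obtain ⟨a, ha⟩ := hσ
  have h1 : x = M.rep (a ⊗ₜ 1) x + M.rep (σ a ⊗ₜ 1) x := by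
    rw [← LinearMap.add_apply, ← map_add, ← TensorProduct.add_tmul, ha,
      ← Algebra.TensorProduct.one_def, map_one, Module.End.one_apply]
  have h2 : M.form x (β • M.rep (σ a ⊗ₜ 1) x) = -M.form x (β • M.rep (a ⊗ₜ 1) x) := by
    rw [← M.rep_tmul_one_smul, ← M.form_rep_tmul_one, M.symm, M.form_smul, hβ, neg_smul, map_neg]
  have h3 : β • x = β • M.rep (a ⊗ₜ 1) x + β • M.rep (σ a ⊗ₜ 1) x := by
    rw [← smul_add, ← h1]
  rw [h3, map_add, h2, add_neg_cancel]

/-- A `B`-linear map lies in the centralizer of `1 ⊗ B`, which is `A ⊗ Z(B) = A ⊗ 1`. -/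
theorem exists_rep_eq [Algebra.IsCentral F B] [IsScalarTower F B V] (f : V →ₗ[B] V) :
    ∃ a : A, ∀ x, M.rep (a ⊗ₜ 1) x = f x := by
  obtain ⟨c, hc⟩ := M.rep.surjective (f.restrictScalars F)
  have hmem : c ∈ Subalgebra.centralizer F
      ((Algebra.TensorProduct.includeRight : B →ₐ[F] A ⊗[F] B).range : Set (A ⊗[F] B)) := by
    rw [Subalgebra.mem_centralizer_iff]
    rintro _ ⟨β, rfl⟩
    apply M.rep.injective
    rw [map_mul, map_mul, hc]
    refine LinearMap.ext fun x => ?_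
    change M.rep (1 ⊗ₜ β) (f x) = f (M.rep (1 ⊗ₜ β) x)
    rw [M.rep_one_tmul, M.rep_one_tmul, map_smul]
  rw [Subalgebra.centralizer_range_includeRight_eq_center_tensorProduct] at hmem
  obtain ⟨z, rfl⟩ := hmem
  have hz : ∃ a : A, Algebra.TensorProduct.map (AlgHom.id F A) (Subalgebra.center F B).val z =
      a ⊗ₜ 1 := by
    clear hc
    induction z using TensorProduct.induction_on with
    | zero => exact ⟨0, by simp⟩
    | add x y hx hy =>
      obtain ⟨a, ha⟩ := hx
      obtain ⟨b, hb⟩ := hy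
      exact ⟨a + b, by rw [map_add, ha, hb, TensorProduct.add_tmul]⟩
    | tmul a y =>
      obtain ⟨y, hy⟩ := y
      rw [Algebra.IsCentral.center_eq_bot, Algebra.mem_bot] at hy
      obtain ⟨c, rfl⟩ := hy
      refine ⟨c • a, ?_⟩
      rw [Algebra.TensorProduct.map_tmul, TensorProduct.smul_tmul]
      simp [Algebra.algebraMap_eq_smul_one]
  obtain ⟨a, ha⟩ := hz
  refine ⟨a, fun x => ?_⟩
  rw [← ha]
  exact LinearMap.congr_fun hc x

end HermitianModel

end Model

/-! ### Even forms, Lagrangians and dimension counts. -/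

section EvenForm

open LinearMap (BilinForm)

variable {F : Type u} [Field F] {B : Type v} [Ring B] [Algebra F B]
  {V : Type w} [AddCommGroup V] [Module F V] [Module B V]
  {V' : Type w} [AddCommGroup V'] [Module F V'] [Module B V']

/-- The bilinear forms obtained by composing the reduced trace with an even hermitian form over
`(B, τ)`. -/
structure IsEvenForm (τ : AlgInvolution F B) (b : BilinForm F V) : Prop where
  nondegenerate : b.Nondegenerate
  symm : ∀ x y, b x y = b y x
  smul : ∀ (β : B) (x y : V), b (β • x) y = b x (τ β • y)
  even : ∀ β : B, τ β = -β → ∀ x : V, b x (β • x) = 0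

/-- The orthogonal difference of two bilinear forms. -/
def orthDiff (b : BilinForm F V) (b' : BilinForm F V') : BilinForm F (V × V') :=
  b.compl₁₂ (LinearMap.fst F V V') (LinearMap.fst F V V') -
    b'.compl₁₂ (LinearMap.snd F V V') (LinearMap.snd F V V')

theorem orthDiff_apply (b : BilinForm F V) (b' : BilinForm F V') (x y : V × V') :
    orthDiff b b' x y = b x.1 y.1 - b' x.2 y.2 := rfl

variable {τ : AlgInvolution F B} {b : BilinForm F V} {b' : BilinForm F V'}

namespace IsEvenForm

theorem smul_right (hb : IsEvenForm τ b) (β : B) (x y : V) : b x (β • y) = b (τ β • x) y := by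
  rw [hb.smul, τ.map_map]

theorem orthDiff (hb : IsEvenForm τ b) (hb' : IsEvenForm τ b') :
    IsEvenForm τ (orthDiff b b') where
  symm x y := by rw [orthDiff_apply, orthDiff_apply, hb.symm, hb'.symm]
  smul β x y := by
    rw [orthDiff_apply, orthDiff_apply, Prod.smul_fst, Prod.smul_snd, hb.smul, hb'.smul]; rfl
  even β hβ x := by
    rw [orthDiff_apply, Prod.smul_fst, Prod.smul_snd, hb.even β hβ, hb'.even β hβ, sub_zero]
  nondegenerate := by
    have key : ∀ x, (∀ y, _root_.orthDiff b b' x y = 0) → x = 0 := by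
      intro x hx
      refine Prod.ext (hb.nondegenerate.1 _ fun y => ?_) (hb'.nondegenerate.1 _ fun y => ?_)
      · simpa [orthDiff_apply] using hx (y, 0)
      · simpa [orthDiff_apply] using hx (0, y)
    refine ⟨key, fun x hx => key x fun y => ?_⟩
    rw [← hx y, orthDiff_apply, orthDiff_apply, hb.symm, hb'.symm]

/-- The orthogonal of a `B`-submodule. -/
def orthogonal (hb : IsEvenForm τ b) (P : Submodule B V) : Submodule B V where
  carrier := {x | ∀ p ∈ P, b p x = 0}
  add_mem' hx hy p hp := by rw [map_add, hx p hp, hy p hp, add_zero]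
  zero_mem' p _ := _root_.map_zero _
  smul_mem' β x hx p hp := by
    rw [hb.smul_right]
    exact hx _ (P.smul_mem _ hp)

variable [IsScalarTower F B V]

theorem orthogonal_restrictScalars (hb : IsEvenForm τ b) (P : Submodule B V) :
    (hb.orthogonal P).restrictScalars F = b.orthogonal (P.restrictScalars F) := rfl

/-- `β - cθ` is skew, so evenness reduces `b(x, βx)` to `c b(x, θx)`. This is the bridge from the
quadratic form back to the hermitian form. -/
theorem apply_self_smul_eq_zero (hb : IsEvenForm τ b)
    (hτ : ∀ β : B, ∃ c : F, β + τ β = algebraMap F B c) {θ : B} (hθ : θ + τ θ = 1) {x : V}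
    (hx : b x (θ • x) = 0) (β : B) : b x (β • x) = 0 := by
  obtain ⟨c, hc⟩ := hτ β
  have h1 : τ (β - c • θ) = -(β - c • θ) := by
    rw [map_sub, map_smul, eq_sub_of_add_eq' hc, eq_sub_of_add_eq' hθ, smul_sub,
      Algebra.algebraMap_eq_smul_one]
    abel
  have h2 : β • x = (β - c • θ) • x + c • (θ • x) := by
    rw [sub_smul, smul_assoc, sub_add_cancel]
  rw [h2, map_add, hb.even _ h1, map_smul, hx, smul_zero, add_zero]

variable [FiniteDimensional F V]

/-- If the quadratic form `x ↦ b(x, θ x)` has a totally singular subspace of half the dimension,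
then so has the hermitian form. -/
theorem exists_lagrangian (hb : IsEvenForm τ b)
    (hτ : ∀ β : B, ∃ c : F, β + τ β = algebraMap F B c) {θ : B} (hθ : θ + τ θ = 1)
    (L : Submodule F V) (hL : ∀ x ∈ L, b x (θ • x) = 0)
    (hdim : 2 * Module.finrank F L = Module.finrank F V) :
    ∃ P : Submodule B V, (∀ x ∈ P, ∀ y ∈ P, b x y = 0) ∧
      2 * Module.finrank F (P.restrictScalars F) = Module.finrank F V := by
  have hnoeth : IsNoetherian B V := isNoetherian_of_tower F inferInstance
  have hLL : ∀ x ∈ L, ∀ y ∈ L, b x y = 0 := by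
    intro x hx y hy
    have h1 := hL _ (L.add_mem hx hy)
    rw [smul_add, map_add, map_add, LinearMap.add_apply, LinearMap.add_apply, hL x hx, hL y hy,
      zero_add, add_zero, hb.symm y, hb.smul, add_comm, ← map_add, ← add_smul, hθ, one_smul] at h1
    exact h1
  -- Any maximal totally isotropic `P` works. A vector `x` of `L` orthogonal to `P` lies in `P`, as
  -- `P + Bx` is again totally isotropic. Hence `(L + P)⊥ ⊆ L ∩ P`, which gives `dim P ≥ dim L`.
  obtain ⟨P, hP, hmax⟩ := (wellFounded_gt (α := Submodule B V)).has_min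
    {P | ∀ x ∈ P, ∀ y ∈ P, b x y = 0} ⟨⊥, by
      intro x hx y _
      rw [(Submodule.mem_bot B).mp hx, _root_.map_zero, LinearMap.zero_apply]⟩
  refine ⟨P, hP, ?_⟩
  let Q := P.restrictScalars F
  have hLQ : L ⊓ b.orthogonal Q ≤ L ⊓ Q := by
    rintro x ⟨hxL, hxQ⟩
    refine ⟨hxL, ?_⟩
    have hxP : ∀ p ∈ P, b p x = 0 := hxQ
    by_contra hx
    refine hmax (P ⊔ Submodule.span B {x}) ?_ ?_
    · intro y hy z hz
      obtain ⟨p, hp, y', hy', rfl⟩ := Submodule.mem_sup.mp hy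
      obtain ⟨q, hq, z', hz', rfl⟩ := Submodule.mem_sup.mp hz
      obtain ⟨β, rfl⟩ := Submodule.mem_span_singleton.mp hy'
      obtain ⟨γ, rfl⟩ := Submodule.mem_span_singleton.mp hz'
      have h1 : b p (γ • x) = 0 := by rw [hb.smul_right]; exact hxP _ (P.smul_mem _ hp)
      have h2 : b (β • x) q = 0 := by
        rw [hb.smul, hb.symm]; exact hxP _ (P.smul_mem _ hq)
      have h3 : b (β • x) (γ • x) = 0 := by
        rw [hb.smul, ← mul_smul]
        exact hb.apply_self_smul_eq_zero hτ hθ (hL x hxL) _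
      rw [map_add, map_add, LinearMap.add_apply, LinearMap.add_apply, hP p hp q hq, h1, h2, h3]
      simp
    · refine lt_of_le_of_ne le_sup_left fun h => hx ?_
      change x ∈ P
      rw [h]
      exact Submodule.mem_sup_right (Submodule.mem_span_singleton_self x)
  have hLo : L ≤ b.orthogonal L := fun x hx y hy => hLL y hy x hx
  have hLo' : b.orthogonal L = L := by
    refine (Submodule.eq_of_le_of_finrank_eq hLo ?_).symm
    rw [BilinForm.finrank_orthogonal hb.nondegenerate]; omega
  have hQo : Q ≤ b.orthogonal Q := fun x hx y hy => hP y hy x hx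
  have h1 : b.orthogonal (L ⊔ Q) ≤ L ⊓ Q := by
    refine le_trans (le_inf ?_ (BilinForm.orthogonal_le le_sup_right)) hLQ
    exact (BilinForm.orthogonal_le le_sup_left).trans hLo'.le
  have h2 := Submodule.finrank_mono h1
  have h3 := Submodule.finrank_mono hQo
  rw [BilinForm.finrank_orthogonal hb.nondegenerate] at h2 h3
  have h4 := Submodule.finrank_sup_add_finrank_inf_eq L Q
  have h5 := Q.finrank_le
  change 2 * Module.finrank F Q = _
  omega

end IsEvenForm

/-- Cutting `K` down to `K ∩ G⊥` costs at most `dim G - dim (K ∩ G)`, and adding `G` regains at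
least as much. -/
theorem LinearMap.BilinForm.finrank_le_inf_orthogonal_sup [FiniteDimensional F V]
    (hb : b.Nondegenerate) (K G : Submodule F V) (hK : K ≤ b.orthogonal K)
    (hdim : 2 * Module.finrank F K = Module.finrank F V) :
    Module.finrank F K ≤ Module.finrank F ((K ⊓ b.orthogonal G) ⊔ G : Submodule F V) := by
  have hKo : b.orthogonal K = K := by
    refine (Submodule.eq_of_le_of_finrank_eq hK ?_).symm
    rw [BilinForm.finrank_orthogonal hb]; omega
  have h1 : b.orthogonal (K ⊔ G) ≤ K ⊓ b.orthogonal G :=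
    le_inf ((BilinForm.orthogonal_le le_sup_left).trans hKo.le)
      (BilinForm.orthogonal_le le_sup_right)
  have h2 := Submodule.finrank_mono h1
  rw [BilinForm.finrank_orthogonal hb] at h2
  have h3 := Submodule.finrank_sup_add_finrank_inf_eq K G
  have h4 := Submodule.finrank_sup_add_finrank_inf_eq (K ⊓ b.orthogonal G) G
  have h5 : Module.finrank F ((K ⊓ b.orthogonal G) ⊓ G : Submodule F V) ≤
      Module.finrank F (K ⊓ G : Submodule F V) :=
    Submodule.finrank_mono (inf_le_inf_right G inf_le_left)
  have h6 := (K ⊔ G).finrank_le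
  omega

/-- Rank–nullity for `p` on `K`: the image lies in `S⊥` and `q` embeds the kernel in `R`. Used with
both projections of a Lagrangian in `V × V'`, to compare its intersections with the factors. -/
theorem finrank_le_of_apply_eq_zero [FiniteDimensional F V] [FiniteDimensional F V']
    (hb : b.Nondegenerate) {E : Type*} [AddCommGroup E] [Module F E] [FiniteDimensional F E]
    (K : Submodule F E) (p : E →ₗ[F] V) (q : E →ₗ[F] V')
    (hpq : ∀ x, p x = 0 → q x = 0 → x = 0) (S : Submodule F V) (R : Submodule F V')
    (hS : ∀ k ∈ K, ∀ s ∈ S, b s (p k) = 0) (hR : ∀ k ∈ K, p k = 0 → q k ∈ R) :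
    Module.finrank F K + Module.finrank F S ≤ Module.finrank F V + Module.finrank F R := by
  let f := p ∘ₗ K.subtype
  have h1 := f.finrank_range_add_finrank_ker
  have h2 : LinearMap.range f ≤ b.orthogonal S := by
    rintro _ ⟨k, rfl⟩ s hs
    exact hS k k.2 s hs
  have h3 := Submodule.finrank_mono h2
  rw [BilinForm.finrank_orthogonal hb] at h3
  let g : LinearMap.ker f →ₗ[F] R :=
    (q ∘ₗ K.subtype ∘ₗ (LinearMap.ker f).subtype).codRestrict R (fun k => hR k k.1.2 k.2)
  have hg : Function.Injective g := by
    rw [injective_iff_map_eq_zero]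
    intro k hk
    exact Subtype.ext (Subtype.ext (hpq _ k.2 (congrArg Subtype.val hk)))
  have h4 := LinearMap.finrank_le_finrank_of_injective hg
  have h5 := S.finrank_le
  omega

/-- Modules over a simple algebra are classified by their dimension. -/
theorem nonempty_linearEquiv_of_finrank_eq [IsSimpleRing B] [FiniteDimensional F B]
    [IsScalarTower F B V] [IsScalarTower F B V'] [FiniteDimensional F V] [FiniteDimensional F V']
    (h : Module.finrank F V = Module.finrank F V') : Nonempty (V ≃ₗ[B] V') := by
  have : IsArtinianRing B := IsArtinianRing.of_finite F B
  obtain ⟨S, hS⟩ := IsAtomic.exists_atom (Submodule B B)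
  rw [← isSimpleModule_iff_isAtom] at hS
  -- Every `B`-module is isotypic of type the minimal left ideal `S`; a finite one is a power of
  -- `S`, with exponent determined by the dimension.
  have key : ∀ (U : Type w) [AddCommGroup U] [Module B U], IsIsotypicOfType B U S := by
    intro U _ _ m _
    obtain ⟨I, ⟨e⟩⟩ := IsSemisimpleRing.exists_linearEquiv_ideal_of_isSimpleModule B m
    have := IsSimpleModule.congr e.symm
    exact ⟨e.trans (IsSimpleRing.isIsotypic B B S I).some⟩
  have : Module.Finite B V := Module.Finite.of_restrictScalars_finite F B V
  have : Module.Finite B V' := Module.Finite.of_restrictScalars_finite F B V'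
  obtain ⟨n, ⟨e⟩⟩ := (key V).linearEquiv_fun
  obtain ⟨n', ⟨e'⟩⟩ := (key V').linearEquiv_fun
  have hpos : 0 < Module.finrank F S := by
    have := IsSimpleModule.nontrivial B S
    exact Module.finrank_pos
  have h1 := (e.restrictScalars F).finrank_eq
  have h2 := (e'.restrictScalars F).finrank_eq
  rw [Module.finrank_pi_fintype] at h1 h2
  have hn : n = n' := by
    simp only [Finset.sum_const, Finset.card_univ, Fintype.card_fin, smul_eq_mul] at h1 h2
    exact Nat.eq_of_mul_eq_mul_right hpos (by rw [← h1, ← h2, h])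
  subst hn
  exact ⟨e.trans e'.symm⟩

end EvenForm

/-! ### From Lagrangians to isometries. -/

section Isometry

open LinearMap (BilinForm)

variable {F : Type u} [Field F] {B : Type v} [Ring B] [Algebra F B]
  {V : Type w} [AddCommGroup V] [Module F V] [Module B V] [IsScalarTower F B V]
  {V' : Type w} [AddCommGroup V'] [Module F V'] [Module B V'] [IsScalarTower F B V']

/-- Every totally isotropic `B`-submodule `S` has a totally isotropic complement of its
orthogonal. -/
def HasIsotropicComplements (B : Type v) [Ring B] [Algebra F B] [Module B V] [IsScalarTower F B V]
    (b : BilinForm F V) : Prop :=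
  ∀ S : Submodule B V, (∀ x ∈ S, ∀ y ∈ S, b x y = 0) →
    ∃ T : Submodule B V, (∀ x ∈ T, ∀ y ∈ T, b x y = 0) ∧
      IsCompl (T.restrictScalars F) (b.orthogonal (S.restrictScalars F))

variable [FiniteDimensional F V] [FiniteDimensional F V']
  {τ : AlgInvolution F B} {b : BilinForm F V} {b' : BilinForm F V'}

theorem finrank_of_isCompl_orthogonal (hb : b.Nondegenerate) {S T : Submodule F V}
    (h : IsCompl T (b.orthogonal S)) : Module.finrank F T = Module.finrank F S := by
  have h1 := Submodule.finrank_add_eq_of_isCompl h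
  rw [BilinForm.finrank_orthogonal hb] at h1
  have := S.finrank_le
  omega

namespace IsEvenForm

/-- A Lagrangian of the difference of two hermitian spaces of the same dimension can be moved to
the graph of an isometry. -/
theorem exists_isometry_of_lagrangian [IsSimpleRing B] [FiniteDimensional F B]
    (hb : IsEvenForm τ b) (hb' : IsEvenForm τ b')
    (hc : HasIsotropicComplements B b) (hc' : HasIsotropicComplements B b')
    (hdim : Module.finrank F V = Module.finrank F V') (K : Submodule B (V × V'))
    (hK : ∀ x ∈ K, ∀ y ∈ K, _root_.orthDiff b b' x y = 0)
    (hKdim : 2 * Module.finrank F (K.restrictScalars F) = Module.finrank F (V × V')) :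
    ∃ φ : V ≃ₗ[B] V', ∀ x y, b' (φ x) (φ y) = b x y := by
  have hd := hb.orthDiff hb'
  -- `S` and `R`, the intersections of `K` with the factors, keep `K` from being a graph. They have
  -- equal dimension.
  let S := K.comap (LinearMap.inl B V V')
  let R := K.comap (LinearMap.inr B V V')
  have hKS : ∀ k ∈ K, ∀ s ∈ S, b s k.1 = 0 := by
    intro k hk s hs
    simpa [orthDiff_apply] using hK _ hs k hk
  have hKR : ∀ k ∈ K, ∀ r ∈ R, b' r k.2 = 0 := by
    intro k hk r hr
    simpa [orthDiff_apply] using hK _ hr k hk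
  have hSS : ∀ x ∈ S, ∀ y ∈ S, b x y = 0 := fun x hx y hy => hKS _ hy x hx
  have hRR : ∀ x ∈ R, ∀ y ∈ R, b' x y = 0 := fun x hx y hy => hKR _ hy x hx
  have hN : Module.finrank F (K.restrictScalars F) = Module.finrank F V := by
    rw [Module.finrank_prod] at hKdim; omega
  have hSR := finrank_le_of_apply_eq_zero hb.nondegenerate (K.restrictScalars F)
    (LinearMap.fst F V V') (LinearMap.snd F V V') (fun x h1 h2 => Prod.ext h1 h2)
    (S.restrictScalars F) (R.restrictScalars F) hKS (by
      rintro ⟨x, y⟩ hk (rfl : x = 0)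
      exact hk)
  have hRS := finrank_le_of_apply_eq_zero hb'.nondegenerate (K.restrictScalars F)
    (LinearMap.snd F V V') (LinearMap.fst F V V') (fun x h1 h2 => Prod.ext h2 h1)
    (R.restrictScalars F) (S.restrictScalars F) hKR (by
      rintro ⟨x, y⟩ hk (rfl : y = 0)
      exact hk)
  obtain ⟨T, hTT, hT⟩ := hc S hSS
  obtain ⟨T', hTT', hT'⟩ := hc' R hRR
  have hTS := finrank_of_isCompl_orthogonal hb.nondegenerate hT
  have hTR := finrank_of_isCompl_orthogonal hb'.nondegenerate hT'
  have hTT'dim : Module.finrank F T = Module.finrank F T' := by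
    change Module.finrank F (T.restrictScalars F) = Module.finrank F (T'.restrictScalars F)
    omega
  have : FiniteDimensional F T := inferInstanceAs (FiniteDimensional F (T.restrictScalars F))
  have : FiniteDimensional F T' := inferInstanceAs (FiniteDimensional F (T'.restrictScalars F))
  obtain ⟨ψ⟩ := nonempty_linearEquiv_of_finrank_eq (F := F) (B := B) hTT'dim
  -- The graph of `ψ : T ≃ T'` is totally isotropic, as `T` and `T'` are. Replacing `K` by `(K ∩ G⊥)
  -- + G` removes the intersection with `V'`.
  let G := LinearMap.range (T.subtype.prod (T'.subtype ∘ₗ ψ.toLinearMap))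
  have hGG : ∀ x ∈ G, ∀ y ∈ G, _root_.orthDiff b b' x y = 0 := by
    rintro _ ⟨x, rfl⟩ _ ⟨y, rfl⟩
    change b x y - b' (ψ x) (ψ y) = 0
    rw [hTT x x.2 y y.2, hTT' _ (ψ x).2 _ (ψ y).2, sub_zero]
  let K' := (K ⊓ hd.orthogonal G) ⊔ G
  have hK'K' : ∀ x ∈ K', ∀ y ∈ K', _root_.orthDiff b b' x y = 0 := by
    intro x hx y hy
    obtain ⟨k, hk, g, hg, rfl⟩ := Submodule.mem_sup.mp hx
    obtain ⟨l, hl, j, hj, rfl⟩ := Submodule.mem_sup.mp hy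
    rw [map_add, map_add, LinearMap.add_apply, LinearMap.add_apply, hK k hk.1 l hl.1,
      hGG g hg j hj, hl.2 g hg, hd.symm, hk.2 j hj]
    simp
  have hK'dim : Module.finrank F V ≤ Module.finrank F (K'.restrictScalars F) := by
    rw [← hN]
    have hK'eq : K'.restrictScalars F = (K.restrictScalars F ⊓
        (_root_.orthDiff b b').orthogonal (G.restrictScalars F)) ⊔ G.restrictScalars F := by
      rw [← hd.orthogonal_restrictScalars, Submodule.restrictScalars_sup,
        Submodule.restrictScalars_inf]
    rw [hK'eq]
    exact BilinForm.finrank_le_inf_orthogonal_sup hd.nondegenerate _ _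
      (fun x hx y hy => hK y hy x hx) hKdim
  -- `T ∩ S⊥ = 0` kills the component in `G`; what is left is a vector of `R` orthogonal to `T'` and
  -- to `R⊥`, hence to all of `V'`. So `K'` is a graph over `V`.
  have hK'0 : ∀ k ∈ K', k.1 = 0 → k = 0 := by
    intro x hx hx1
    obtain ⟨k, hk, g, ⟨t, rfl⟩, rfl⟩ := Submodule.mem_sup.mp hx
    have h1 : k.1 + (t : V) = 0 := hx1
    have ht : (t : V) = 0 := by
      refine (Submodule.mem_bot F).mp (hT.disjoint.le_bot ⟨t.2, fun s hs => ?_⟩)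
      have h2 := hKS k hk.1 s hs
      rw [eq_neg_of_add_eq_zero_left h1, map_neg, neg_eq_zero] at h2
      exact h2
    have ht0 : t = 0 := Subtype.ext ht
    subst ht0
    rw [_root_.map_zero, add_zero]
    have hk1 : k.1 = 0 := by simpa using h1
    refine Prod.ext hk1 (hb'.nondegenerate.2 _ fun y => ?_)
    have hkR : k.2 ∈ R := by
      change ((0 : V), k.2) ∈ K
      rw [← hk1]
      exact hk.1
    have hy : y ∈ (T'.restrictScalars F) ⊔ (b'.orthogonal (R.restrictScalars F)) := by
      rw [hT'.sup_eq_top]; trivial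
    obtain ⟨t', ht', r, hr, rfl⟩ := Submodule.mem_sup.mp hy
    have h3 : b' t' k.2 = 0 := by
      have h4 := hk.2 _ ⟨ψ.symm ⟨t', ht'⟩, rfl⟩
      rw [orthDiff_apply, hk1, _root_.map_zero, zero_sub, neg_eq_zero] at h4
      simpa using h4
    rw [map_add, LinearMap.add_apply, h3, hb'.symm, hr _ hkR, add_zero]
  let p : K' →ₗ[B] V := LinearMap.fst B V V' ∘ₗ K'.subtype
  have hp : Function.Injective p := by
    rw [injective_iff_map_eq_zero]
    intro k hk
    exact Subtype.ext (hK'0 k k.2 hk)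
  have : FiniteDimensional F K' := inferInstanceAs (FiniteDimensional F (K'.restrictScalars F))
  have hpF : Function.Injective (p.restrictScalars F) := hp
  have hp' : Function.Surjective (p.restrictScalars F) := by
    refine (LinearMap.injective_iff_surjective_of_finrank_eq_finrank ?_).mp hpF
    exact le_antisymm (LinearMap.finrank_le_finrank_of_injective hpF) hK'dim
  let e := LinearEquiv.ofBijective p ⟨hp, hp'⟩
  let q : V →ₗ[B] V' := LinearMap.snd B V V' ∘ₗ K'.subtype ∘ₗ e.symm.toLinearMap
  have hq : ∀ x y, b' (q x) (q y) = b x y := by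
    intro x y
    have h1 := hK'K' _ (e.symm x).2 _ (e.symm y).2
    rw [orthDiff_apply, sub_eq_zero] at h1
    have h2 : ∀ z, (e.symm z : V × V').1 = z := fun z => e.apply_symm_apply z
    rw [h2, h2] at h1
    exact h1.symm
  have hqinj : Function.Injective (q.restrictScalars F) := by
    rw [injective_iff_map_eq_zero]
    intro x hx
    apply hb.nondegenerate.1
    intro y
    rw [← hq, show q x = 0 from hx, _root_.map_zero, LinearMap.zero_apply]
  have hqsurj := (LinearMap.injective_iff_surjective_of_finrank_eq_finrank hdim).mp hqinj
  exact ⟨LinearEquiv.ofBijective q ⟨hqinj, hqsurj⟩, hq⟩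

/-- Hermitian spaces are isometric as soon as their quadratic forms `x ↦ b(x, θ x)` are. -/
theorem exists_isometry [IsSimpleRing B] [FiniteDimensional F B]
    (hb : IsEvenForm τ b) (hb' : IsEvenForm τ b')
    (hc : HasIsotropicComplements B b) (hc' : HasIsotropicComplements B b')
    (hτ : ∀ β : B, ∃ c : F, β + τ β = algebraMap F B c) {θ : B} (hθ : θ + τ θ = 1)
    (g : V ≃ₗ[F] V') (hg : ∀ x, b' (g x) (θ • g x) = b x (θ • x)) :
    ∃ φ : V ≃ₗ[B] V', ∀ x y, b' (φ x) (φ y) = b x y := by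
  let f : V →ₗ[F] V × V' := LinearMap.id.prod g.toLinearMap
  have hf : Function.Injective f := fun x y h => congrArg Prod.fst h
  obtain ⟨K, hK, hKdim⟩ := (hb.orthDiff hb').exists_lagrangian hτ hθ (LinearMap.range f) (by
    rintro _ ⟨x, rfl⟩
    change b x (θ • x) - b' (g x) (θ • g x) = 0
    rw [hg, sub_self]) (by
    rw [LinearMap.finrank_range_of_inj hf, Module.finrank_prod, g.finrank_eq, two_mul])
  exact hb.exists_isometry_of_lagrangian hb' hc hc' g.finrank_eq K hK hKdim

end IsEvenForm

end Isometry

/-! ### Totally isotropic submodules and idempotents of `A`. -/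

section ModelGeometry

variable {F : Type u} [Field F] {A B : Type v} [Ring A] [Algebra F A] [Ring B] [Algebra F B]

namespace HermitianModel

variable {σ : AlgInvolution F A} {τ : AlgInvolution F B} {V : Type w}
  [AddCommGroup V] [Module F V] [Module B V] (M : HermitianModel σ τ V)

theorem isEvenForm (hσ : ∃ a, a + σ a = 1) : IsEvenForm τ M.form where
  nondegenerate := M.nondegenerate
  symm := M.symm
  smul := M.form_smul
  even _ hβ x := M.form_self_smul hσ hβ x

theorem eq_of_form_rep {c d : A ⊗[F] B}
    (h : ∀ x y, M.form x (M.rep c y) = M.form x (M.rep d y)) : c = d := by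
  apply M.rep.injective
  refine LinearMap.ext fun y => ?_
  rw [← sub_eq_zero]
  apply M.nondegenerate.2
  intro x
  rw [map_sub, h, sub_self]

theorem eq_of_form_rep_tmul_one [Nontrivial B] {a a' : A}
    (h : ∀ x y, M.form x (M.rep (a ⊗ₜ 1) y) = M.form x (M.rep (a' ⊗ₜ 1) y)) : a = a' :=
  Algebra.TensorProduct.includeLeft_injective (R := F) (S := F) (A := A) (B := B)
    (algebraMap F B).injective (M.eq_of_form_rep h)

theorem rep_mul_tmul_one (a a' : A) (x : V) :
    M.rep ((a * a') ⊗ₜ 1) x = M.rep (a ⊗ₜ 1) (M.rep (a' ⊗ₜ 1) x) := by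
  rw [← Module.End.mul_apply, ← map_mul, Algebra.TensorProduct.tmul_mul_tmul, one_mul]

/-- Every totally isotropic submodule `S` gives an idempotent of `A` whose kernel is the
orthogonal of `S` and whose image is totally isotropic. -/
theorem exists_idempotent [Algebra.IsCentral F B] [IsSimpleRing B] [FiniteDimensional F B]
    [IsScalarTower F B V] (hσ : ∃ a, a + σ a = 1) (S : Submodule B V)
    (hS : ∀ x ∈ S, ∀ y ∈ S, M.form x y = 0) :
    ∃ e : A, e * e = e ∧ σ e * e = 0 ∧
      ∀ x, M.rep (e ⊗ₜ 1) x = 0 ↔ ∀ s ∈ S, M.form s x = 0 := by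
  have : IsArtinianRing B := IsArtinianRing.of_finite F B
  obtain ⟨a, ha⟩ := hσ
  obtain ⟨S', hS'⟩ := exists_isCompl S
  obtain ⟨p, hp⟩ := M.exists_rep_eq (S.subtype ∘ₗ S.projectionOnto S' hS')
  have hpS : ∀ x, M.rep (p ⊗ₜ 1) x ∈ S := fun x => by
    rw [hp]; exact (S.projectionOnto S' hS' x).2
  have hpx : ∀ x ∈ S, M.rep (p ⊗ₜ 1) x = x := fun x hx => by
    rw [hp]
    exact congrArg Subtype.val (Submodule.projectionOnto_apply_left hS' ⟨x, hx⟩)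
  have hpp : p * p = p := by
    apply M.eq_of_form_rep_tmul_one
    intro x y
    rw [M.rep_mul_tmul_one, hpx _ (hpS y)]
  have hπp : σ p * p = 0 := by
    apply M.eq_of_form_rep_tmul_one
    intro x y
    rw [M.rep_mul_tmul_one, ← M.form_rep_tmul_one, hS _ (hpS x) _ (hpS y), TensorProduct.zero_tmul,
      map_zero, LinearMap.zero_apply, map_zero]
  have hππ : σ p * σ p = σ p := by rw [← σ.map_mul_rev, hpp]
  have hσπ : σ (σ p) = p := σ.map_map p
  set π := σ p
  have hkill : ∀ x y : A, x * π * (p * y) = 0 := fun x y => by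
    rw [mul_assoc, ← mul_assoc π, hπp, zero_mul, mul_zero]
  -- `π` is an idempotent with kernel `S⊥`, and `πp = 0`. The correction `paπ` makes the image
  -- totally isotropic, using `a + σ(a) = 1`; the kernel stays the same because `πe = π`.
  let e := π - p * a * π
  have hπe : π * e = π := by
    change π * (π - p * a * π) = π
    rw [mul_sub, hππ, mul_assoc p, ← mul_assoc π, hπp, zero_mul, sub_zero]
  have heπ : e = (1 - p * a) * π := by rw [sub_mul, one_mul]
  refine ⟨e, ?_, ?_, fun x => ?_⟩
  · calc e * e = (1 - p * a) * (π * e) := by rw [← mul_assoc, ← heπ]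
      _ = e := by rw [hπe, ← heπ]
  · have h1 : σ e = p * (1 - σ a * π) := by
      change σ (π - p * a * π) = _
      rw [map_sub, σ.map_mul_rev, σ.map_mul_rev, hσπ, mul_sub, mul_one]
    have h2 : σ a = 1 - a := eq_sub_of_add_eq' ha
    calc σ e * e = p * (e - σ a * (π * e)) := by rw [h1, mul_assoc, sub_mul, one_mul, mul_assoc]
      _ = p * π - p * p * a * π - p * σ a * π := by rw [hπe]; simp only [e]; noncomm_ring
      _ = 0 := by rw [hpp, h2]; noncomm_ring
  · constructor
    · intro h s hs
      have h1 : M.rep (π ⊗ₜ 1) x = 0 := by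
        rw [← hπe, M.rep_mul_tmul_one, h, map_zero]
      rw [← hpx s hs, M.form_rep_tmul_one, h1, map_zero]
    · intro h
      have h1 : M.rep (π ⊗ₜ 1) x = 0 := by
        apply M.nondegenerate.2
        intro y
        rw [← M.form_rep_tmul_one, h _ (hpS y)]
      rw [heπ, M.rep_mul_tmul_one, h1, map_zero]

/-- The elements of `A` as `B`-linear endomorphisms. -/
noncomputable def repEnd [IsScalarTower F B V] : A →ₐ[F] Module.End B V :=
  AlgHom.ofLinearMap
    { toFun := fun a =>
        { toFun := M.rep (a ⊗ₜ 1)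
          map_add' := map_add _
          map_smul' := M.rep_tmul_one_smul a }
      map_add' := fun a a' => LinearMap.ext fun x => by
        change M.rep ((a + a') ⊗ₜ 1) x = M.rep (a ⊗ₜ 1) x + M.rep (a' ⊗ₜ 1) x
        rw [TensorProduct.add_tmul, map_add, LinearMap.add_apply]
      map_smul' := fun c a => LinearMap.ext fun x => by
        change M.rep ((c • a) ⊗ₜ 1) x = c • M.rep (a ⊗ₜ 1) x
        rw [← TensorProduct.smul_tmul', map_smul, LinearMap.smul_apply] }
    (LinearMap.ext fun x => by
      change M.rep (1 ⊗ₜ 1) x = x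
      rw [← Algebra.TensorProduct.one_def, map_one, Module.End.one_apply])
    (fun a a' => LinearMap.ext (M.rep_mul_tmul_one a a'))

theorem repEnd_apply [IsScalarTower F B V] (a : A) (x : V) :
    M.repEnd a x = M.rep (a ⊗ₜ 1) x := rfl

theorem repEnd_bijective [IsScalarTower F B V] [Algebra.IsCentral F B] [Nontrivial B] :
    Function.Bijective M.repEnd := by
  refine ⟨fun a a' h => M.eq_of_form_rep_tmul_one fun x y => ?_, fun f => ?_⟩
  · rw [← repEnd_apply, h, repEnd_apply]
  · obtain ⟨a, ha⟩ := M.exists_rep_eq f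
    exact ⟨a, LinearMap.ext ha⟩

theorem hasIsotropicComplements [Algebra.IsCentral F B] [IsSimpleRing B] [FiniteDimensional F B]
    [IsScalarTower F B V] (hσ : ∃ a, a + σ a = 1) : HasIsotropicComplements B M.form := by
  intro S hS
  obtain ⟨e, hee, hσe, hker⟩ := M.exists_idempotent hσ S hS
  refine ⟨LinearMap.range (M.repEnd e), ?_, ?_⟩
  · rintro _ ⟨x, rfl⟩ _ ⟨y, rfl⟩
    rw [repEnd_apply, repEnd_apply, M.form_rep_tmul_one, ← M.rep_mul_tmul_one, hσe,
      TensorProduct.zero_tmul, map_zero, LinearMap.zero_apply, map_zero]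
  · have hmem : ∀ x, x ∈ M.form.orthogonal (S.restrictScalars F) ↔ M.rep (e ⊗ₜ 1) x = 0 :=
      fun x => (hker x).symm
    refine IsCompl.of_le ?_ ?_
    · rintro _ ⟨⟨x, rfl⟩, hx⟩
      have h1 := (hmem _).mp hx
      rw [repEnd_apply, ← M.rep_mul_tmul_one, hee] at h1
      exact (Submodule.mem_bot F).mpr h1
    · intro x _
      refine Submodule.mem_sup.mpr ⟨M.rep (e ⊗ₜ 1) x, ⟨x, rfl⟩, x - M.rep (e ⊗ₜ 1) x, ?_, by abel⟩
      rw [hmem, map_sub, ← M.rep_mul_tmul_one, hee, sub_self]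

/-- Rescaling the form of a model. -/
noncomputable def rescale {c : F} (hc : c ≠ 0) : HermitianModel σ τ V where
  rep := M.rep
  rep_one_tmul := M.rep_one_tmul
  form := c • M.form
  nondegenerate := by
    have h := M.nondegenerate
    refine ⟨fun x hx => h.1 x fun y => ?_, fun x hx => h.2 x fun y => ?_⟩
    · exact (mul_eq_zero.mp (hx y)).resolve_left hc
    · exact (mul_eq_zero.mp (hx y)).resolve_left hc
  symm x y := by rw [LinearMap.smul_apply, LinearMap.smul_apply, LinearMap.smul_apply,
    LinearMap.smul_apply, M.symm]
  form_rep d x y := by rw [LinearMap.smul_apply, LinearMap.smul_apply, LinearMap.smul_apply,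
    LinearMap.smul_apply, M.form_rep]

/-- An isometry of `B`-modules induces an isomorphism of algebras with involution. -/
theorem isomorphic_of_isometry [Algebra.IsCentral F B] [Nontrivial B] [IsScalarTower F B V]
    {A' : Type v} [Ring A'] [Algebra F A'] {σ' : AlgInvolution F A'}
    {V' : Type w} [AddCommGroup V'] [Module F V'] [Module B V'] [IsScalarTower F B V']
    (M' : HermitianModel σ' τ V') (φ : V ≃ₗ[B] V')
    (hφ : ∀ x y, M'.form (φ x) (φ y) = M.form x y) : σ.Isomorphic σ' := by
  let E := AlgEquiv.ofBijective M.repEnd M.repEnd_bijective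
  let E' := AlgEquiv.ofBijective M'.repEnd M'.repEnd_bijective
  let ε : A ≃ₐ[F] A' := (E.trans (φ.conjAlgEquiv F)).trans E'.symm
  have hε : ∀ a x, M'.rep (ε a ⊗ₜ 1) (φ x) = φ (M.rep (a ⊗ₜ 1) x) := by
    intro a x
    have h1 : E' (ε a) = φ.conjAlgEquiv F (E a) := E'.apply_symm_apply _
    have h2 := LinearMap.congr_fun h1 (φ x)
    rw [LinearEquiv.conjAlgEquiv_apply, LinearMap.comp_apply, LinearMap.comp_apply] at h2
    simp only [LinearEquiv.coe_coe, LinearEquiv.symm_apply_apply] at h2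
    exact h2
  refine ⟨ε, fun a => M'.eq_of_form_rep_tmul_one fun x y => ?_⟩
  obtain ⟨x, rfl⟩ := φ.surjective x
  obtain ⟨y, rfl⟩ := φ.surjective y
  rw [hε, hφ, ← M.form_rep_tmul_one, ← M'.form_rep_tmul_one, hε, hφ]

end HermitianModel

end ModelGeometry

/-! ### The semi-trace of the box product. -/

section BoxSemiTrace

variable {F : Type u} [Field F] {A B : Type v} [Ring A] [Algebra F A] [Ring B] [Algebra F B]
  {σ : AlgInvolution F A} {τ : AlgInvolution F B}

/-- In characteristic two, the symmetric elements of `A ⊗ B` are sums of symmetrized elements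
and of tensors of symmetric elements. -/
theorem AlgInvolution.exists_sym_tensor_decomposition [Nontrivial B]
    (h2 : (2 : F) = 0) (hτ : τ.IsCanonical) {θ : B} (hθ : hτ.traceForm θ = 1) {z : A ⊗[F] B}
    (hz : σ.tensor τ z = z) :
    ∃ x : A ⊗[F] B, ∃ w ∈ Submodule.span F {w | ∃ s ∈ σ.sym, ∃ t ∈ τ.sym, w = s ⊗ₜ[F] t},
      z = x + σ.tensor τ x + w := by
  have hadd : ∀ m : A ⊗[F] B, m + m = 0 := fun m => by
    rw [← two_smul F, h2, zero_smul]
  have haddA : ∀ m : A, m + m = 0 := fun m => by rw [← two_smul F, h2, zero_smul]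
  have haddB : ∀ m : B, m + m = 0 := fun m => by rw [← two_smul F, h2, zero_smul]
  have hneg : ∀ m : A ⊗[F] B, -m = m := fun m => neg_eq_of_add_eq_zero_left (hadd m)
  let T := hτ.traceForm
  have hT : ∀ y, τ y = T y • 1 + y := fun y => by
    have h := hτ.algebraMap_traceForm y
    rw [Algebra.algebraMap_eq_smul_one] at h
    rw [h, add_comm y, add_assoc, haddB, add_zero]
  have hT1 : T 1 = 0 := by
    apply (algebraMap F B).injective
    rw [hτ.algebraMap_traceForm, τ.apply_one, haddB, _root_.map_zero]
  have hTτ : ∀ y, T (τ y) = T y := hτ.traceForm_map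
  let ev : (B →ₗ[F] F) → (A ⊗[F] B →ₗ[F] A) := fun φ =>
    (TensorProduct.rid F A).toLinearMap ∘ₗ φ.lTensor A
  have hev : ∀ φ a y, ev φ (a ⊗ₜ y) = φ y • a := fun φ a y => TensorProduct.rid_tmul _ _
  have hJ : ∀ w, σ.tensor τ w = ev T (σ.toLin.rTensor B w) ⊗ₜ 1 + σ.toLin.rTensor B w := by
    intro w
    induction w using TensorProduct.induction_on with
    | zero => simp
    | add x y hx hy => rw [map_add, hx, hy, map_add, map_add, TensorProduct.add_tmul]; abel
    | tmul a y =>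
      rw [tensor_tmul, LinearMap.rTensor_tmul, hev, hT, TensorProduct.tmul_add,
        TensorProduct.smul_tmul]
  have hevσ : ∀ φ w, ev φ (σ.toLin.rTensor B w) = σ (ev φ w) := by
    intro φ w
    induction w using TensorProduct.induction_on with
    | zero => simp
    | add x y hx hy => rw [map_add, map_add, hx, hy, map_add, map_add]
    | tmul a y => rw [LinearMap.rTensor_tmul, hev, hev, map_smul]
  let P : B →ₗ[F] B := LinearMap.id + T.smulRight θ
  have hP : ∀ y, P y = y + T y • θ := fun _ => rfl
  have hPsym : ∀ y, P y ∈ τ.sym := by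
    intro y
    have h1 : T (P y) = 0 := by
      rw [hP, map_add, map_smul, show T θ = 1 from hθ, smul_eq_mul, mul_one, ← two_mul, h2,
        zero_mul]
    rw [mem_sym, hT, h1, zero_smul, zero_add]
  have hPten : ∀ w, P.lTensor A w = w + ev T w ⊗ₜ θ := by
    intro w
    induction w using TensorProduct.induction_on with
    | zero => simp
    | add x y hx hy => rw [map_add, hx, hy, map_add, TensorProduct.add_tmul]; abel
    | tmul a y =>
      rw [LinearMap.lTensor_tmul, hP, TensorProduct.tmul_add, hev, TensorProduct.smul_tmul]
  obtain ⟨l, hl⟩ : ∃ l : B →ₗ[F] F, l 1 = 1 := Module.Projective.exists_dual_eq_one F one_ne_zero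
  -- `z₀ = z + x ⊗ θ` is killed by `id ⊗ Trd`, and `z₀ + (σ ⊗ id)(z₀) = x ⊗ 1`. A linear form `l`
  -- with `l 1 = 1` turns this into `x = y + σ(y)`, so that `z₀ + y ⊗ 1` is fixed by `σ ⊗ id`.
  set x := ev T z with hx
  have hσx : σ x = x := by
    conv_rhs => rw [hx, ← hz, hJ, map_add, hev, hT1, zero_smul, zero_add, hevσ]
  let z₀ := z + x ⊗ₜ[F] θ
  have hz₀ : z₀ + σ.toLin.rTensor B z₀ = x ⊗ₜ 1 := by
    have h1 := hJ z
    rw [hz, hevσ, ← hx, hσx] at h1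
    have h3 : σ.toLin.rTensor B z = z + x ⊗ₜ 1 := by
      conv_rhs => rw [h1]
      rw [add_right_comm, hadd, zero_add]
    change z + x ⊗ₜ θ + σ.toLin.rTensor B (z + x ⊗ₜ θ) = _
    rw [map_add, LinearMap.rTensor_tmul, hσx, h3]
    calc z + x ⊗ₜ[F] θ + (z + x ⊗ₜ 1 + x ⊗ₜ θ)
        = (z + z) + (x ⊗ₜ θ + x ⊗ₜ θ) + x ⊗ₜ 1 := by abel
      _ = _ := by rw [hadd, hadd, zero_add, zero_add]
  have hTz₀ : ev T z₀ = 0 := by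
    change ev T (z + x ⊗ₜ θ) = 0
    rw [map_add, hev, show T θ = 1 from hθ, one_smul, haddA]
  let y := ev l z₀
  have hy : y + σ y = x := by
    have h1 := congrArg (ev l) hz₀
    rwa [map_add, hevσ, hev, hl, one_smul] at h1
  let z₁ := z₀ + y ⊗ₜ[F] 1
  have hz₁ : σ.toLin.rTensor B z₁ = z₁ := by
    have h1 : σ.toLin.rTensor B z₀ = z₀ + x ⊗ₜ 1 := by
      rw [← hz₀, ← add_assoc, hadd, zero_add]
    change σ.toLin.rTensor B (z₀ + y ⊗ₜ 1) = z₀ + y ⊗ₜ 1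
    rw [map_add, h1, LinearMap.rTensor_tmul, add_assoc, ← TensorProduct.add_tmul]
    congr 2
    rw [← hy, add_assoc, haddA, add_zero]
  have hPz₁ : P.lTensor A z₁ = z₁ := by
    have h1 : ev T z₁ = 0 := by
      change ev T (z₀ + y ⊗ₜ 1) = 0
      rw [map_add, hTz₀, hev, hT1, zero_smul, zero_add]
    rw [hPten, h1, TensorProduct.zero_tmul, add_zero]
  have hz₁mem : z₁ ∈ Submodule.span F {w | ∃ s ∈ σ.sym, ∃ t ∈ τ.sym, w = s ⊗ₜ[F] t} := by
    -- By flatness the elements fixed by `σ ⊗ id` form `Sym(σ) ⊗ B`; the map `P` then brings the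
    -- second factor into `Sym(τ)`.
    have hex : Function.Exact σ.sym.subtype (σ.toLin - LinearMap.id : A →ₗ[F] A) := by
      intro a
      rw [LinearMap.sub_apply, sub_eq_zero]
      constructor
      · intro h; exact ⟨⟨a, h⟩, rfl⟩
      · rintro ⟨a, rfl⟩; exact a.2
    obtain ⟨w, hw⟩ := (Module.Flat.rTensor_exact (M := B) hex z₁).mp (by
      rw [LinearMap.rTensor_sub, LinearMap.sub_apply, hz₁, LinearMap.rTensor_id,
        LinearMap.id_apply, sub_self])
    rw [← hPz₁, ← hw]
    clear hw
    induction w using TensorProduct.induction_on with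
    | zero => simp
    | add p q hp hq => rw [map_add, map_add]; exact Submodule.add_mem _ hp hq
    | tmul s t =>
      exact Submodule.subset_span ⟨s, s.2, P t, hPsym t, rfl⟩
  refine ⟨y ⊗ₜ θ, z₁ + x ⊗ₜ 1, Submodule.add_mem _ hz₁mem
    (Submodule.subset_span ⟨x, hσx, 1, τ.apply_one, rfl⟩), ?_⟩
  have hτθ : τ θ = 1 + θ := by rw [hT, show T θ = 1 from hθ, one_smul]
  rw [tensor_tmul, hτθ, TensorProduct.tmul_add]
  change z = y ⊗ₜ θ + (σ y ⊗ₜ 1 + σ y ⊗ₜ θ) + (z + x ⊗ₜ θ + y ⊗ₜ 1 + x ⊗ₜ 1)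
  calc z = z + (x ⊗ₜ θ + x ⊗ₜ θ) + (x ⊗ₜ 1 + x ⊗ₜ 1) := by rw [hadd, hadd, add_zero, add_zero]
    _ = z + ((y + σ y) ⊗ₜ θ + x ⊗ₜ θ) + ((y + σ y) ⊗ₜ 1 + x ⊗ₜ 1) := by rw [hy]
    _ = _ := by rw [TensorProduct.add_tmul, TensorProduct.add_tmul]; abel

namespace SemiTrace

theorem two_mul_apply {C : Type v} [Ring C] [Algebra F C] {J : AlgInvolution F C}
    (k : SemiTrace J) (s : J.sym) : 2 * k.toLin s = reducedTrace F (s : C) := by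
  rw [← k.apply_add_map, two_mul, ← map_add]
  congr 1
  apply Subtype.ext
  change (s : C) + s = s + J s
  rw [AlgInvolution.mem_sym.mp s.2]

theorem ext' {C : Type v} [Ring C] [Algebra F C] {J : AlgInvolution F C}
    {k h : SemiTrace J} (H : ∀ s, k.toLin s = h.toLin s) : k = h := by
  cases k; cases h
  congr 1
  exact LinearMap.ext H

theorem charP_two_of_two_eq_zero (h2 : (2 : F) = 0) : CharP F 2 :=
  CharTwo.of_one_ne_zero_of_two_eq_zero one_ne_zero h2

theorem two_ne_zero_of_not_charP (h : ¬ CharP F 2) : (2 : F) ≠ 0 :=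
  fun h2 => h (charP_two_of_two_eq_zero h2)

/-- There is at most one semi-trace that defines the quadratic pair of `(A, σ) ⊠ (B, τ)`. -/
theorem IsBox.unique [Nontrivial B] (hτ : τ.IsCanonical) {θ : B} (hθ : hτ.traceForm θ = 1)
    {k h : SemiTrace (σ.tensor τ)} (hk : k.IsBox σ τ) (hh : h.IsBox σ τ) : k = h := by
  apply ext'
  intro s
  by_cases h2 : (2 : F) = 0
  · have hchar := charP_two_of_two_eq_zero h2
    obtain ⟨x, w, hw, hs⟩ := AlgInvolution.exists_sym_tensor_decomposition h2 hτ hθ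
      (AlgInvolution.mem_sym.mp s.2)
    have key : ∀ f : SemiTrace (σ.tensor τ), f.IsBox σ τ →
        f.toLin s = reducedTrace F x := by
      intro f hf
      have hle : Submodule.span F {w | ∃ s ∈ σ.sym, ∃ t ∈ τ.sym, w = s ⊗ₜ[F] t} ≤
          (LinearMap.ker f.toLin).map (σ.tensor τ).sym.subtype := by
        rw [Submodule.span_le]
        rintro _ ⟨a, ha, t, ht, rfl⟩
        exact ⟨⟨a ⊗ₜ t, AlgInvolution.tmul_mem_sym ha ht⟩, hf.char_two hchar a ha t ht, rfl⟩
      obtain ⟨w', hw', rfl⟩ := hle hw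
      rw [← f.apply_add_map]
      have : s = ⟨x + σ.tensor τ x, (σ.tensor τ).add_map_mem_sym x⟩ + w' := Subtype.ext hs
      rw [this, map_add, show f.toLin w' = 0 from hw', add_zero]
    rw [key k hk, key h hh]
  · have hchar : ¬ CharP F 2 := fun hc => h2 (CharP.cast_eq_zero F 2)
    rw [hk.char_ne_two hchar, hh.char_ne_two hchar]

end SemiTrace

namespace HermitianModel

variable {V : Type w} [AddCommGroup V] [Module F V] [Module B V] [FiniteDimensional F V]
  (M : HermitianModel σ τ V)

theorem trace_rep_map (c : A ⊗[F] B) :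
    LinearMap.trace F V (M.rep (σ.tensor τ c)) = LinearMap.trace F V (M.rep c) := by
  rw [← LinearMap.trace_conj' (M.rep c) (M.form.toDual M.nondegenerate), ← LinearMap.trace_transpose']
  congr 1
  refine LinearMap.ext fun φ => LinearMap.ext fun y => ?_
  obtain ⟨x, rfl⟩ := (M.form.toDual M.nondegenerate).surjective φ
  rw [LinearEquiv.conj_apply]
  simp only [LinearMap.comp_apply, LinearEquiv.coe_coe, LinearEquiv.symm_apply_apply]
  change M.form.toDual M.nondegenerate x (M.rep (σ.tensor τ c) y) = _
  rw [LinearMap.BilinForm.toDual_def, LinearMap.BilinForm.toDual_def, M.form_rep]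

omit [FiniteDimensional F V] in
theorem trace_rep_mul_comm (c d : A ⊗[F] B) :
    LinearMap.trace F V (M.rep (c * d)) = LinearMap.trace F V (M.rep (d * c)) := by
  rw [_root_.map_mul M.rep, _root_.map_mul M.rep, LinearMap.trace_mul_comm]

omit [FiniteDimensional F V] in
-- For fixed `x`, the trace of `x ⊗ t` vanishes on commutators in `t`, so it is a multiple of
-- `Trd(t)`.
theorem trace_rep_tmul_eq_zero [Algebra.IsCentral F B] [IsSimpleRing B] [FiniteDimensional F B]
    (hB : Module.finrank F B = 4) (hτ : τ.IsCanonical) (x : A) {t : B}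
    (ht : hτ.traceForm t = 0) : LinearMap.trace F V (M.rep (x ⊗ₜ t)) = 0 := by
  refine hτ.apply_eq_zero_of_mul_comm hB
    (LinearMap.trace F V ∘ₗ M.rep.toLinearMap ∘ₗ TensorProduct.mk F A B x) (fun y z => ?_) ht
  change LinearMap.trace F V (M.rep (x ⊗ₜ (y * z))) = LinearMap.trace F V (M.rep (x ⊗ₜ (z * y)))
  have h1 : x ⊗ₜ[F] (y * z) = (x ⊗ₜ y) * (1 ⊗ₜ z) := by simp
  have h2 : x ⊗ₜ[F] (z * y) = (1 ⊗ₜ z) * (x ⊗ₜ y) := by simp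
  rw [h1, h2, M.trace_rep_mul_comm]

/-- The semi-trace `s ↦ Trd(l s)`, for `l` with `l + (σ ⊗ τ)(l) = 1`. -/
noncomputable def semiTrace (l : A ⊗[F] B) (hl : l + σ.tensor τ l = 1) :
    SemiTrace (σ.tensor τ) where
  toLin := LinearMap.trace F V ∘ₗ M.rep.toLinearMap ∘ₗ LinearMap.mulLeft F l ∘ₗ
    (σ.tensor τ).sym.subtype
  apply_add_map x := by
    change LinearMap.trace F V (M.rep (l * (x + σ.tensor τ x))) = _
    rw [reducedTrace_eq_trace M.rep, mul_add, map_add, map_add, ← M.trace_rep_map (l * σ.tensor τ x),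
      (σ.tensor τ).map_mul_rev, (σ.tensor τ).map_map, M.trace_rep_mul_comm x, ← map_add, ← map_add,
      ← add_mul, hl, one_mul]

theorem semiTrace_apply (l : A ⊗[F] B) (hl : l + σ.tensor τ l = 1) (s : (σ.tensor τ).sym) :
    (M.semiTrace l hl).toLin s = LinearMap.trace F V (M.rep (l * s)) := rfl

theorem semiTrace_char_ne_two (l : A ⊗[F] B) (hl : l + σ.tensor τ l = 1) (h : ¬ CharP F 2)
    (s : (σ.tensor τ).sym) :
    (M.semiTrace l hl).toLin s = 2⁻¹ * reducedTrace F (s : A ⊗[F] B) := by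
  rw [← SemiTrace.two_mul_apply, ← mul_assoc,
    inv_mul_cancel₀ (SemiTrace.two_ne_zero_of_not_charP h), one_mul]

variable [Algebra.IsCentral F B] [IsSimpleRing B] [FiniteDimensional F B]

theorem isBox_semiTrace_left (hB : Module.finrank F B = 4) (hτ : τ.IsCanonical) {e : A}
    (he : e ⊗ₜ[F] (1 : B) + σ.tensor τ (e ⊗ₜ 1) = 1) :
    (M.semiTrace (e ⊗ₜ 1) he).IsBox σ τ where
  char_ne_two := M.semiTrace_char_ne_two _ he
  char_two hchar s hs t ht := by
    rw [semiTrace_apply, Algebra.TensorProduct.tmul_mul_tmul, one_mul]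
    apply M.trace_rep_tmul_eq_zero hB hτ
    apply (algebraMap F B).injective
    rw [hτ.algebraMap_traceForm, AlgInvolution.mem_sym.mp ht, ← two_smul F,
      show (2 : F) = 0 from CharP.cast_eq_zero F 2, zero_smul, map_zero]

/-- In characteristic two write `s = sa + sσ(a)` and `y = θt`. Invariance of the trace under `σ ⊗ τ`
moves the second part to `sa ⊗ τ(y)`, and `y + τ(y)` is a scalar, of reduced trace `0`. -/
theorem isBox_semiTrace_right (hB : Module.finrank F B = 4) (hτ : τ.IsCanonical)
    (hσ : ∃ a, a + σ a = 1) {θ : B}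
    (hθ : (1 : A) ⊗ₜ[F] θ + σ.tensor τ (1 ⊗ₜ θ) = 1) :
    (M.semiTrace (1 ⊗ₜ θ) hθ).IsBox σ τ where
  char_ne_two := M.semiTrace_char_ne_two _ hθ
  char_two hchar s hs t _ := by
    have h2 : (2 : F) = 0 := CharP.cast_eq_zero F 2
    obtain ⟨a, ha⟩ := hσ
    rw [semiTrace_apply, Algebra.TensorProduct.tmul_mul_tmul, one_mul]
    set y := θ * t
    have h1 : LinearMap.trace F V (M.rep ((s * σ a) ⊗ₜ y)) =
        LinearMap.trace F V (M.rep ((s * a) ⊗ₜ τ y)) := by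
      rw [← M.trace_rep_map, AlgInvolution.tensor_tmul, σ.map_mul_rev, σ.map_map,
        AlgInvolution.mem_sym.mp hs]
      have h3 : (a * s) ⊗ₜ[F] τ y = (a ⊗ₜ 1) * (s ⊗ₜ τ y) := by simp
      have h4 : (s * a) ⊗ₜ[F] τ y = (s ⊗ₜ τ y) * (a ⊗ₜ 1) := by simp
      rw [h3, h4, M.trace_rep_mul_comm]
    have h5 : s ⊗ₜ[F] y = (s * a) ⊗ₜ y + (s * σ a) ⊗ₜ y := by
      rw [← TensorProduct.add_tmul, ← mul_add, ha, mul_one]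
    rw [h5, map_add, map_add, h1, ← map_add, ← map_add, ← TensorProduct.tmul_add]
    apply M.trace_rep_tmul_eq_zero hB hτ
    rw [map_add, hτ.traceForm_map, ← two_mul, h2, zero_mul]

end HermitianModel

end BoxSemiTrace

/-! ### The three equivalences. -/

namespace AlgInvolution.IsCanonical

variable {F : Type u} [Field F] {A B : Type v} [Ring A] [Algebra F A] [Ring B] [Algebra F B]
  {σ : AlgInvolution F A} {τ : AlgInvolution F B}

theorem exists_add_map_eq_algebraMap (hτ : τ.IsCanonical) (β : B) :
    ∃ c : F, β + τ β = algebraMap F B c :=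
  ⟨_, hτ.add_map β⟩

variable [Nontrivial B] (hτ : τ.IsCanonical)

theorem add_map_eq_one {θ : B} (hθ : hτ.traceForm θ = 1) : θ + τ θ = 1 := by
  rw [← hτ.algebraMap_traceForm, hθ, map_one]

theorem one_tmul_add_map {θ : B} (hθ : hτ.traceForm θ = 1) :
    (1 : A) ⊗ₜ[F] θ + σ.tensor τ (1 ⊗ₜ θ) = 1 := by
  rw [tensor_tmul, σ.apply_one, ← TensorProduct.tmul_add, hτ.add_map_eq_one hθ,
    Algebra.TensorProduct.one_def]

end AlgInvolution.IsCanonical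

namespace HermitianModel

section RankOne

variable {F : Type u} [Field F] {A B : Type v} [Ring A] [Algebra F A] [Ring B] [Algebra F B]
  {σ : AlgInvolution F A} {τ : AlgInvolution F B} {V : Type w}
  [AddCommGroup V] [Module F V] [Module B V] (M : HermitianModel σ τ V)

/-- The element of `A ⊗ B` acting as `y ↦ b(v, y) u`. -/
noncomputable def rankOne (v u : V) : A ⊗[F] B := M.rep.symm ((M.form v).smulRight u)

theorem rep_rankOne (v u : V) : M.rep (M.rankOne v u) = (M.form v).smulRight u :=
  M.rep.apply_symm_apply _

theorem rep_rankOne_apply (v u y : V) : M.rep (M.rankOne v u) y = M.form v y • u := by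
  rw [rep_rankOne]; rfl

theorem mul_rankOne (c : A ⊗[F] B) (v u : V) :
    c * M.rankOne v u = M.rankOne v (M.rep c u) := by
  apply M.rep.injective
  refine LinearMap.ext fun y => ?_
  rw [map_mul, Module.End.mul_apply, rep_rankOne_apply, rep_rankOne_apply, map_smul]

theorem rankOne_self_mem_sym (v : V) : M.rankOne v v ∈ (σ.tensor τ).sym := by
  rw [AlgInvolution.mem_sym]
  refine M.eq_of_form_rep fun x y => ?_
  rw [← M.form_rep, rep_rankOne_apply, rep_rankOne_apply, map_smul, map_smul,
    LinearMap.smul_apply, smul_eq_mul, smul_eq_mul, M.symm x v, mul_comm]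

variable [FiniteDimensional F V]

theorem trace_rep_mul_rankOne (c : A ⊗[F] B) (v u : V) :
    LinearMap.trace F V (M.rep (c * M.rankOne v u)) = M.form v (M.rep c u) := by
  rw [mul_rankOne, rep_rankOne, LinearMap.trace_smulRight]

theorem eq_of_trace_rep_mul {c d : A ⊗[F] B}
    (h : ∀ x, LinearMap.trace F V (M.rep (c * x)) = LinearMap.trace F V (M.rep (d * x))) :
    c = d :=
  M.eq_of_form_rep fun v u => by
    rw [← M.trace_rep_mul_rankOne, h, M.trace_rep_mul_rankOne]

end RankOne

variable {F : Type u} [Field F] {A B : Type v} [Ring A] [Algebra F A] [Ring B] [Algebra F B]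
  [Algebra.IsCentral F B] [IsSimpleRing B] [FiniteDimensional F B]
  {σ : AlgInvolution F A} {τ : AlgInvolution F B} {V : Type w}
  [AddCommGroup V] [Module F V] [Module B V] [IsScalarTower F B V] [FiniteDimensional F V]
  (M : HermitianModel σ τ V)

theorem isIsotropic_iff (hτ : τ.IsCanonical) (hσ : ∃ a, a + σ a = 1) {θ : B}
    (hθ : hτ.traceForm θ = 1) :
    σ.IsIsotropic ↔ (M.semiTrace (1 ⊗ₜ θ) (hτ.one_tmul_add_map hθ)).IsIsotropic := by
  constructor
  · rintro ⟨a, ha, hσa⟩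
    have hmem : ∀ x ∈ Submodule.span (A ⊗[F] B)ᵐᵒᵖ {a ⊗ₜ[F] (1 : B)},
        ∃ c, x = (a ⊗ₜ 1) * c := by
      intro x hx
      obtain ⟨c, rfl⟩ := Submodule.mem_span_singleton.mp hx
      exact ⟨c.unop, rfl⟩
    have hzero : ∀ c d e, σ.tensor τ ((a ⊗ₜ 1) * c) * (((1 : A) ⊗ₜ d) * ((a ⊗ₜ 1) * e)) = 0 := by
      intro c d e
      have h1 : (σ a ⊗ₜ[F] (1 : B)) * (((1 : A) ⊗ₜ d) * (a ⊗ₜ 1)) = 0 := by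
        rw [Algebra.TensorProduct.tmul_mul_tmul, Algebra.TensorProduct.tmul_mul_tmul, one_mul, hσa,
          TensorProduct.zero_tmul]
      rw [(σ.tensor τ).map_mul_rev, AlgInvolution.tensor_tmul, τ.apply_one,
        ← mul_assoc (1 ⊗ₜ d), mul_assoc, ← mul_assoc (σ a ⊗ₜ 1), h1, zero_mul, mul_zero]
    refine ⟨Submodule.span _ {a ⊗ₜ[F] (1 : B)}, ?_, ?_, ?_⟩
    · rw [Ne, Submodule.span_singleton_eq_bot]
      intro h
      exact ha (M.eq_of_form_rep_tmul_one fun x y => by rw [h, TensorProduct.zero_tmul])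
    · intro x hx y hy
      obtain ⟨c, rfl⟩ := hmem x hx
      obtain ⟨d, rfl⟩ := hmem y hy
      have := hzero c 1 d
      rwa [← Algebra.TensorProduct.one_def, one_mul] at this
    · intro s hs
      obtain ⟨c, hc⟩ := hmem _ hs
      rw [semiTrace_apply]
      -- `s(1 ⊗ θ)s = 0` makes `(1 ⊗ θ)s` nilpotent, hence of trace `0`.
      have hsq : (s : A ⊗[F] B) * (((1 : A) ⊗ₜ[F] θ) * (s : A ⊗[F] B)) = 0 := by
        have h1 := hzero c θ c
        rwa [← hc, AlgInvolution.mem_sym.mp s.2] at h1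
      have hnil : IsNilpotent (M.rep (((1 : A) ⊗ₜ[F] θ) * (s : A ⊗[F] B))) := by
        refine ⟨2, ?_⟩
        rw [← map_pow, pow_two, mul_assoc, hsq, mul_zero, map_zero]
      exact (LinearMap.isNilpotent_trace_of_isNilpotent hnil).eq_zero
  · rintro ⟨I, hI, -, hI0⟩
    obtain ⟨x, hxI, hx⟩ := I.ne_bot_iff.mp hI
    obtain ⟨y, hy⟩ : ∃ y, M.rep x y ≠ 0 := by
      by_contra! h
      exact hx (M.eq_of_form_rep fun p q => by rw [h, map_zero M.rep, LinearMap.zero_apply])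
    set z := M.rep x y
    -- A vector `z` in the image of an element of `I` gives a symmetric rank one element of `I`, on
    -- which the semi-trace is `b(z, θz)`.
    have hmem : M.rankOne z z ∈ I := by
      have := I.smul_mem (MulOpposite.op (M.rankOne z y)) hxI
      rwa [MulOpposite.smul_eq_mul_unop, MulOpposite.unop_op, mul_rankOne] at this
    have hq := hI0 ⟨_, M.rankOne_self_mem_sym z⟩ hmem
    rw [semiTrace_apply, trace_rep_mul_rankOne, M.rep_one_tmul] at hq
    have hev := M.isEvenForm hσ
    have hB : ∀ β, M.form z (β • z) = 0 :=
      hev.apply_self_smul_eq_zero hτ.exists_add_map_eq_algebraMap (hτ.add_map_eq_one hθ) hq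
    obtain ⟨e, -, hσe, hker⟩ := M.exists_idempotent hσ (Submodule.span B {z}) (by
      intro p hp q hq
      obtain ⟨β, rfl⟩ := Submodule.mem_span_singleton.mp hp
      obtain ⟨γ, rfl⟩ := Submodule.mem_span_singleton.mp hq
      rw [M.form_smul, ← mul_smul, hB])
    refine ⟨e, ?_, hσe⟩
    rintro rfl
    refine hy (M.nondegenerate.1 z fun q => ?_)
    exact (hker q).mp (by rw [TensorProduct.zero_tmul, map_zero, LinearMap.zero_apply]) z
      (Submodule.mem_span_singleton_self z)

theorem isHyperbolic_iff (hB : Module.finrank F B = 4) (hτ : τ.IsCanonical)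
    (hσ : ∃ a, a + σ a = 1) {θ : B} (hθ : hτ.traceForm θ = 1) :
    σ.IsHyperbolic ↔ (M.semiTrace (1 ⊗ₜ θ) (hτ.one_tmul_add_map hθ)).IsHyperbolic := by
  constructor
  · rintro ⟨e, he, hσe⟩
    have he1 : e ⊗ₜ[F] (1 : B) + σ.tensor τ (e ⊗ₜ 1) = 1 := by
      rw [AlgInvolution.tensor_tmul, τ.apply_one, hσe, ← TensorProduct.add_tmul, add_sub_cancel,
        Algebra.TensorProduct.one_def]
    -- `1 ⊗ θ` and `e ⊗ 1` represent the same semi-trace, and `e ⊗ 1` is idempotent.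
    have heq := SemiTrace.IsBox.unique hτ hθ
      (M.isBox_semiTrace_right hB hτ hσ (hτ.one_tmul_add_map hθ))
      (M.isBox_semiTrace_left hB hτ he1)
    refine ⟨e ⊗ₜ 1, ?_, fun s => ?_⟩
    · change _ * _ = _
      rw [Algebra.TensorProduct.tmul_mul_tmul, he.eq, one_mul]
    · rw [heq, semiTrace_apply, reducedTrace_eq_trace M.rep]
  · rintro ⟨e, he, hs⟩
    have hs' : ∀ s : (σ.tensor τ).sym,
        LinearMap.trace F V (M.rep (((1 : A) ⊗ₜ[F] θ) * (s : A ⊗[F] B))) =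
          LinearMap.trace F V (M.rep (e * (s : A ⊗[F] B))) := fun s => by
      rw [← reducedTrace_eq_trace M.rep, ← reducedTrace_eq_trace M.rep, ← hs,
        reducedTrace_eq_trace M.rep, semiTrace_apply]
    -- Evaluating the semi-trace on `x + (σ ⊗ τ)(x)` shows that `e + (σ ⊗ τ)(e)` and `1` have the
    -- same trace pairing with every `x`.
    have hJe : σ.tensor τ e = 1 - e := by
      apply eq_sub_of_add_eq'
      refine M.eq_of_trace_rep_mul fun x => ?_
      have h1 := (M.semiTrace _ (hτ.one_tmul_add_map hθ)).apply_add_map x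
      rw [semiTrace_apply, hs', reducedTrace_eq_trace M.rep] at h1
      rw [one_mul, ← h1, add_mul, mul_add, map_add, map_add, map_add, map_add,
        ← M.trace_rep_map (e * σ.tensor τ x), (σ.tensor τ).map_mul_rev, (σ.tensor τ).map_map,
        M.trace_rep_mul_comm x]
    have hee : ∀ x, M.rep e (M.rep e x) = M.rep e x := fun x => by
      rw [← Module.End.mul_apply, ← map_mul, he.eq]
    have hrep : ∀ x, M.rep (1 - e) x = x - M.rep e x := fun x => by
      rw [map_sub, LinearMap.sub_apply, map_one, Module.End.one_apply]
    let L := LinearMap.range (M.rep e)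
    have hL : ∀ x ∈ L, ∀ y ∈ L, M.form x y = 0 := by
      rintro _ ⟨x, rfl⟩ _ ⟨y, rfl⟩
      rw [M.form_rep, hJe, hrep, hee, sub_self, map_zero]
    have hLo : M.form.orthogonal L = L := by
      refine le_antisymm (fun x hx => ⟨x, ?_⟩) (fun x hx y hy => hL y hy x hx)
      rw [← sub_eq_zero, ← neg_sub, neg_eq_zero, ← hrep, ← hJe]
      apply M.nondegenerate.2
      intro y
      rw [← M.form_rep]
      exact hx _ ⟨y, rfl⟩
    have hdim : 2 * Module.finrank F L = Module.finrank F V := by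
      have h1 := LinearMap.BilinForm.finrank_orthogonal M.nondegenerate L
      have h2 := L.finrank_le
      rw [hLo] at h1
      omega
    have hev := M.isEvenForm hσ
    -- Tested on the rank one element of `x`, the condition on `e` reads `b(x, θx) = b(x, ex)`,
    -- which is `0` for `x` in the image of `e`.
    obtain ⟨P, hP, hPdim⟩ := hev.exists_lagrangian hτ.exists_add_map_eq_algebraMap
      (hτ.add_map_eq_one hθ) L (by
        intro x hx
        have h1 := hs' ⟨_, M.rankOne_self_mem_sym x⟩
        rw [trace_rep_mul_rankOne, trace_rep_mul_rankOne, M.rep_one_tmul] at h1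
        rw [h1]
        exact hL x hx _ ⟨x, rfl⟩) hdim
    obtain ⟨f, hff, hσf, hker⟩ := M.exists_idempotent hσ P hP
    have hPo : ∀ x, (∀ s ∈ P, M.form s x = 0) → x ∈ P := by
      have h1 : P.restrictScalars F = M.form.orthogonal (P.restrictScalars F) := by
        refine Submodule.eq_of_le_of_finrank_eq (fun x hx y hy => hP y hy x hx) ?_
        rw [LinearMap.BilinForm.finrank_orthogonal M.nondegenerate]
        omega
      intro x hx
      change x ∈ P.restrictScalars F
      rw [h1]
      exact hx
    refine ⟨f, hff, ?_⟩
    apply eq_sub_of_add_eq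
    refine M.eq_of_form_rep_tmul_one fun x y => ?_
    -- The kernel of `f` is `P⊥ = P`, so `f` and `1 - f` both have totally isotropic image;
    -- expanding gives `σ(f) + f = 1`.
    have hmem : ∀ x, x - M.rep (f ⊗ₜ 1) x ∈ P := fun x => by
      apply hPo
      rw [← hker, map_sub, ← M.rep_mul_tmul_one, hff, sub_self]
    have h1 := hP _ (hmem x) _ (hmem y)
    have h2 : M.form (M.rep (f ⊗ₜ 1) x) (M.rep (f ⊗ₜ 1) y) = 0 := by
      rw [M.form_rep_tmul_one, ← M.rep_mul_tmul_one, hσf, TensorProduct.zero_tmul, map_zero,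
        LinearMap.zero_apply, map_zero]
    rw [map_sub, map_sub, LinearMap.sub_apply, LinearMap.sub_apply, h2, sub_zero] at h1
    rw [TensorProduct.add_tmul, map_add, LinearMap.add_apply, map_add, ← M.form_rep_tmul_one,
      ← Algebra.TensorProduct.one_def, map_one, Module.End.one_apply]
    linear_combination -h1

theorem isomorphic_iff (hτ : τ.IsCanonical) (hσ : ∃ a, a + σ a = 1) {θ : B}
    (hθ : hτ.traceForm θ = 1) {A' : Type v} [Ring A'] [Algebra F A'] [Nontrivial A']
    {σ' : AlgInvolution F A'} {V' : Type w} [AddCommGroup V'] [Module F V'] [Module B V']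
    [IsScalarTower F B V'] [FiniteDimensional F V'] (M' : HermitianModel σ' τ V')
    (hσ' : ∃ a, a + σ' a = 1) :
    σ.Isomorphic σ' ↔ (M.semiTrace (1 ⊗ₜ θ) (hτ.one_tmul_add_map hθ)).Isomorphic
      (M'.semiTrace (1 ⊗ₜ θ) (hτ.one_tmul_add_map hθ)) := by
  constructor
  · rintro ⟨ε, hε⟩
    let E : A ⊗[F] B ≃ₐ[F] A' ⊗[F] B := Algebra.TensorProduct.congr ε AlgEquiv.refl
    have hEt : ∀ a β, E (a ⊗ₜ β) = ε a ⊗ₜ β := fun _ _ => rfl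
    have hE : AlgInvolution.IsIso (σ.tensor τ) (σ'.tensor τ) E := by
      intro x
      induction x using TensorProduct.induction_on with
      | zero => simp
      | add x y hx hy => simp only [map_add, hx, hy]
      | tmul a β =>
        rw [AlgInvolution.tensor_tmul, hEt, hEt, AlgInvolution.tensor_tmul, hε]
    refine ⟨E, hE, fun s => ?_⟩
    rw [semiTrace_apply, semiTrace_apply]
    have h1 : ((1 : A') ⊗ₜ[F] θ) * E s = E (((1 : A) ⊗ₜ[F] θ) * (s : A ⊗[F] B)) := by
      rw [map_mul, hEt, map_one]
    change _ = LinearMap.trace F V' (M'.rep ((1 ⊗ₜ θ) * E s))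
    rw [h1, ← reducedTrace_eq_trace M.rep, reducedTrace_eq_trace (E.trans M'.rep),
      AlgEquiv.trans_apply]
  · rintro ⟨E, hE, hs⟩
    -- `E` is conjugation by a linear map `T`. Pulled back along `T`, the form of `M'` is adjoint to
    -- `σ ⊗ τ`, so it is `c` times that of `M`. Rank one elements show that `T` scales the quadratic
    -- forms by `c` too, and rescaling the model absorbs `c` without changing `σ`.
    obtain ⟨T, hT⟩ := (M.rep.symm.trans (E.trans M'.rep)).eq_linearEquivConjAlgEquiv
    have hTE : ∀ c x, M'.rep (E c) (T x) = T (M.rep c x) := by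
      intro c x
      have h1 := LinearMap.congr_fun (AlgEquiv.congr_fun hT (M.rep c)) (T x)
      rw [LinearEquiv.conjAlgEquiv_apply, AlgEquiv.trans_apply, AlgEquiv.symm_apply_apply,
        AlgEquiv.trans_apply] at h1
      simpa using h1
    obtain ⟨c, hc⟩ := (σ.tensor τ).adjoint_form_unique M.rep (b := M.form)
      (b' := M'.form.compl₁₂ T.toLinearMap T.toLinearMap) M.nondegenerate M.form_rep (by
        intro d x y
        change M'.form (T (M.rep d x)) (T y) = M'.form (T x) (T (M.rep (σ.tensor τ d) y))
        rw [← hTE, ← hTE, M'.form_rep, hE])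
    have hc' : ∀ x y, M'.form (T x) (T y) = c * M.form x y := hc
    have hc0 : c ≠ 0 := by
      rintro rfl
      have : Nontrivial V' := by
        by_contra h
        rw [not_nontrivial_iff_subsingleton] at h
        exact not_subsingleton (A' ⊗[F] B) (M'.rep.toEquiv.subsingleton)
      obtain ⟨x, hx⟩ := exists_ne (0 : V')
      refine hx (M'.nondegenerate.1 x fun y => ?_)
      rw [← T.apply_symm_apply x, ← T.apply_symm_apply y, hc', zero_mul]
    have hrank : ∀ x, c • E (M.rankOne x x) = M'.rankOne (T x) (T x) := by
      intro x
      apply M'.rep.injective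
      refine LinearMap.ext fun y => ?_
      obtain ⟨y, rfl⟩ := T.surjective y
      rw [map_smul, LinearMap.smul_apply, hTE, rep_rankOne_apply, rep_rankOne_apply, hc', map_smul,
        smul_smul]
    have hg : ∀ x, M'.form (T x) (θ • T x) = (M.rescale hc0).form x (θ • x) := by
      intro x
      have h1 := hs ⟨_, M.rankOne_self_mem_sym x⟩
      rw [semiTrace_apply, semiTrace_apply] at h1
      change _ = LinearMap.trace F V' (M'.rep ((1 ⊗ₜ θ) * E (M.rankOne x x))) at h1
      rw [trace_rep_mul_rankOne, M.rep_one_tmul] at h1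
      change _ = c * M.form x (θ • x)
      rw [h1, ← smul_eq_mul, ← LinearMap.map_smul (LinearMap.trace F V'),
        ← _root_.map_smul M'.rep c, ← mul_smul_comm, hrank, trace_rep_mul_rankOne, M'.rep_one_tmul]
    obtain ⟨φ, hφ⟩ := ((M.rescale hc0).isEvenForm hσ).exists_isometry (M'.isEvenForm hσ')
      ((M.rescale hc0).hasIsotropicComplements hσ) (M'.hasIsotropicComplements hσ')
      hτ.exists_add_map_eq_algebraMap (hτ.add_map_eq_one hθ) T hg
    exact (M.rescale hc0).isomorphic_of_isometry M' φ hφ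

end HermitianModel

theorem corollary5p4 {F : Type u} [Field F]
    {A A' B : Type v}
    [Ring A] [Algebra F A] [Algebra.IsCentral F A] [IsSimpleRing A] [FiniteDimensional F A]
    [Ring A'] [Algebra F A'] [Algebra.IsCentral F A'] [IsSimpleRing A'] [FiniteDimensional F A']
    [Ring B] [Algebra F B] [Algebra.IsCentral F B] [IsSimpleRing B] [FiniteDimensional F B]
    -- `(B, τ)` is a quaternion algebra with its canonical involution
    (hB : Module.finrank F B = 4) (τ : AlgInvolution F B) (hτ : τ.IsCanonical)
    (σ : AlgInvolution F A) (hσ : σ.IsSymplectic) (hA : BrauerEquiv F A B)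
    (σ' : AlgInvolution F A') (hσ' : σ'.IsSymplectic) (hA' : BrauerEquiv F A' B) :
    -- the semi-traces `h`, `h'` of `(A, σ) ⊠ (B, τ)` and `(A', σ') ⊠ (B, τ)` are well defined
    ∃ h : SemiTrace (σ.tensor τ), ∃ h' : SemiTrace (σ'.tensor τ),
      (h.IsBox σ τ ∧ ∀ k : SemiTrace (σ.tensor τ), k.IsBox σ τ → k = h) ∧
      (h'.IsBox σ' τ ∧ ∀ k : SemiTrace (σ'.tensor τ), k.IsBox σ' τ → k = h') ∧
      (σ.IsIsotropic ↔ h.IsIsotropic) ∧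
      (σ.IsHyperbolic ↔ h.IsHyperbolic) ∧
      (σ.Isomorphic σ' ↔ h.Isomorphic h') := by
  obtain ⟨θ, hθ⟩ := hτ.exists_traceForm_eq_one hB
  obtain ⟨V, _, _, _, _, _, ⟨M⟩⟩ := exists_hermitianModel hB hτ hσ hA
  obtain ⟨V', _, _, _, _, _, ⟨M'⟩⟩ := exists_hermitianModel hB hτ hσ' hA'
  have ha := hσ.exists_add_map_eq_one
  have ha' := hσ'.exists_add_map_eq_one
  have hbox := M.isBox_semiTrace_right hB hτ ha (hτ.one_tmul_add_map hθ)
  have hbox' := M'.isBox_semiTrace_right hB hτ ha' (hτ.one_tmul_add_map hθ)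
  exact ⟨_, _, ⟨hbox, fun k hk => SemiTrace.IsBox.unique hτ hθ hk hbox⟩,
    ⟨hbox', fun k hk => SemiTrace.IsBox.unique hτ hθ hk hbox'⟩,
    M.isIsotropic_iff hτ ha hθ, M.isHyperbolic_iff hB hτ ha hθ,
    M.isomorphic_iff hτ ha hθ M' ha'⟩
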